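/- Let $n\ge 0$ and let $W=W(B_n)=\{\pm1\}^n\rtimes S_n$ be the Weyl group of type $B_n$, acting on its reflection representation $E=\mathbb R^n$ by signed permutations. For a finite group $G$ let $R(G)$ be the Grothendieck group of finite-dimensional complex representations of $G$. The character pairing on $R(S_n)$ is $\langle\sigma,\sigma'\rangle_{S_n}=\frac1{n!}\sum_{g\in S_n}\sigma(g)\sigma'(g^{-1})$, and the elliptic pairing on $R(W)$ is $$\langle\sigma,\sigma'\rangle^{\mathrm{el}}_W=\frac1{|W|}\sum_{w\in W}\sigma(w)\sigma'(w)\det\nolimits_E(1-w),$$ where virtual representations are evaluated through their characters. Let $\overline R(W)=R(W)/\operatorname{rad}\langle\ ,\ \rangle^{\mathrm{el}}_W$, with the induced pairing. For a partition $\lambda$ of $n$ let $\sigma_\lambda$ be the irreducible representation of $S_n$ attached to $\lambda$ (the Specht module, normalized so that $\sigma_{(n)}$ is trivial and $\sigma_{(1,\dots,1)}$ is the sign), and let $\lambda\times\emptyset$ be the irreducible representation of $W$ obtained by inflating $\sigma_\lambda$ along $W\to S_n$. Then the classes $[\lambda\times\emptyset]$, $\lambda\vdash n$, form a $\mathbb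 Z$-basis of $\overline R(W)$ that is orthonormal for $\langle\ ,\ \rangle^{\mathrm{el}}_W$. More precisely, there is a unique additive map $R(S_n)\to\overline R(W)$ with $\sigma_\lambda\mapsto[\lambda\times\emptyset]$ for all $\lambda\vdash n$, and it is an isomorphism that carries $\langle\ ,\ \rangle_{S_n}$ to $\langle\ ,\ \rangle^{\mathrm{el}}_W$. -/

import Mathlib

open scoped BigOperators

noncomputable section

/-! ### The Grothendieck group of finite-dimensional complex representations -/

/-- The relations `[Y] = [X] + [Z]`, one for every short exact sequence `0 → X → Y → Z → 0` of
finite-dimensional complex representations of `G`. -/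
def exactRelations (G : Type) [Group G] : Set (FreeAbelianGroup (FDRep ℂ G)) :=
  {r | ∃ (X Y Z : FDRep ℂ G) (i : X →ₗ[ℂ] Y) (p : Y →ₗ[ℂ] Z),
    (∀ g : G, i ∘ₗ X.ρ g = Y.ρ g ∘ₗ i) ∧ (∀ g : G, p ∘ₗ Y.ρ g = Z.ρ g ∘ₗ p) ∧
    Function.Injective i ∧ Function.Exact i p ∧ Function.Surjective p ∧
    r = FreeAbelianGroup.of Y - FreeAbelianGroup.of X - FreeAbelianGroup.of Z}

/-- The Grothendieck group `R(G)` of finite-dimensional complex representations of `G`. -/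
abbrev RepGroup (G : Type) [Group G] : Type 1 :=
  FreeAbelianGroup (FDRep ℂ G) ⧸ AddSubgroup.closure (exactRelations G)

/-- The class in `R(G)` of a representation. -/
def repClass {G : Type} [Group G] (V : FDRep ℂ G) : RepGroup G :=
  QuotientAddGroup.mk (FreeAbelianGroup.of V)

/-- The trace is additive along short exact sequences. -/
theorem trace_of_exact {X Y Z : Type} [AddCommGroup X] [Module ℂ X] [FiniteDimensional ℂ X]
    [AddCommGroup Y] [Module ℂ Y] [FiniteDimensional ℂ Y]
    [AddCommGroup Z] [Module ℂ Z] [FiniteDimensional ℂ Z]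
    (i : X →ₗ[ℂ] Y) (p : Y →ₗ[ℂ] Z) (hi : Function.Injective i) (he : Function.Exact i p)
    (hp : Function.Surjective p) (a : X →ₗ[ℂ] X) (b : Y →ₗ[ℂ] Y) (c : Z →ₗ[ℂ] Z)
    (hab : i ∘ₗ a = b ∘ₗ i) (hbc : p ∘ₗ b = c ∘ₗ p) :
    LinearMap.trace ℂ Y b = LinearMap.trace ℂ X a + LinearMap.trace ℂ Z c := by
  obtain ⟨s, hs⟩ := p.exists_rightInverse_of_surjective (LinearMap.range_eq_top.2 hp)
  obtain ⟨r₀, hr₀⟩ := i.exists_leftInverse_of_injective (LinearMap.ker_eq_bot.2 hi)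
  have hs' : ∀ z, p (s z) = z := fun z => LinearMap.congr_fun hs z
  have hr' : ∀ x, r₀ (i x) = x := fun x => LinearMap.congr_fun hr₀ x
  have hpi : ∀ x, p (i x) = 0 := fun x => (he (i x)).2 ⟨x, rfl⟩
  let r : Y →ₗ[ℂ] X := r₀ ∘ₗ (LinearMap.id - s ∘ₗ p)
  have hri : r ∘ₗ i = LinearMap.id := by
    ext x; simp [r, hpi, hr']
  have hsum : i ∘ₗ r + s ∘ₗ p = LinearMap.id := by
    ext y
    obtain ⟨x, hx⟩ := (he (y - s (p y))).1 (by simp [hs'])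
    have : i (r y) = y - s (p y) := by simp [r, ← hx, hr']
    simp [this]
  have h1 : b = (b ∘ₗ i) ∘ₗ r + (b ∘ₗ s) ∘ₗ p := by
    rw [LinearMap.comp_assoc, LinearMap.comp_assoc, ← LinearMap.comp_add, hsum,
      LinearMap.comp_id]
  have h2 : LinearMap.trace ℂ Y b = LinearMap.trace ℂ Y ((b ∘ₗ i) ∘ₗ r) +
      LinearMap.trace ℂ Y ((b ∘ₗ s) ∘ₗ p) := by
    rw [← map_add, ← h1]
  rw [h2, LinearMap.trace_comp_comm' r (b ∘ₗ i), LinearMap.trace_comp_comm' p (b ∘ₗ s),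
    ← hab, ← LinearMap.comp_assoc, hri, LinearMap.id_comp, ← LinearMap.comp_assoc, hbc,
    LinearMap.comp_assoc, hs, LinearMap.comp_id]

/-- The character of a virtual representation: the additive map with `[V] ↦ χ_V`. -/
def virtualCharacter (G : Type) [Group G] : RepGroup G →+ (G → ℂ) :=
  QuotientAddGroup.lift _ (FreeAbelianGroup.lift fun V : FDRep ℂ G => V.character) (by
    rw [AddSubgroup.closure_le]
    rintro _ ⟨X, Y, Z, i, p, hX, hZ, hi, he, hp, rfl⟩
    have key : Y.character = X.character + Z.character :=
      funext fun g => trace_of_exact i p hi he hp (X.ρ g) (Y.ρ g) (Z.ρ g) (hX g) (hZ g)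
    simp [AddMonoidHom.mem_ker, key])

theorem virtualCharacter_repClass {G : Type} [Group G] (V : FDRep ℂ G) :
    virtualCharacter G (repClass V) = V.character := by
  simp [virtualCharacter, repClass]

/-- The character pairing `⟨x, y⟩_G` on `R(G)`. -/
def characterPairing {G : Type} [Group G] [Fintype G] (x y : RepGroup G) : ℂ :=
  (Fintype.card G : ℂ)⁻¹ * ∑ g : G, virtualCharacter G x g * virtualCharacter G y g⁻¹

/-! ### The elliptic pairing -/

section Elliptic

variable {W : Type} [Group W] [Fintype W] {E : Type} [AddCommGroup E] [Module ℝ E]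

/-- The elliptic pairing on `R(W)` with respect to a real representation `E` of `W`:
`⟨x, y⟩^el = |W|⁻¹ ∑_w x(w) y(w) det_E(1 - w)`. -/
def ellipticPairing (ρ : Representation ℝ W E) (x y : RepGroup W) : ℂ :=
  (Fintype.card W : ℂ)⁻¹ * ∑ w : W, virtualCharacter W x w * virtualCharacter W y w *
    ((LinearMap.det (1 - ρ w) : ℝ) : ℂ)

theorem ellipticPairing_comm (ρ : Representation ℝ W E) (x y : RepGroup W) :
    ellipticPairing ρ x y = ellipticPairing ρ y x := by
  unfold ellipticPairing
  congr 1
  exact Finset.sum_congr rfl fun w _ => by ring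

theorem ellipticPairing_add_left (ρ : Representation ℝ W E) (x x' y : RepGroup W) :
    ellipticPairing ρ (x + x') y = ellipticPairing ρ x y + ellipticPairing ρ x' y := by
  simp only [ellipticPairing, map_add, Pi.add_apply, add_mul, Finset.sum_add_distrib, mul_add]

theorem ellipticPairing_neg_left (ρ : Representation ℝ W E) (x y : RepGroup W) :
    ellipticPairing ρ (-x) y = -ellipticPairing ρ x y := by
  simp only [ellipticPairing, map_neg, Pi.neg_apply, neg_mul, Finset.sum_neg_distrib, mul_neg]

/-- The radical of the elliptic pairing. -/
def ellipticRadical (ρ : Representation ℝ W E) : AddSubgroup (RepGroup W) where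
  carrier := {x | ∀ y, ellipticPairing ρ x y = 0}
  zero_mem' := fun y => by simp [ellipticPairing]
  add_mem' := fun {a b} ha hb y => by rw [ellipticPairing_add_left, ha y, hb y, add_zero]
  neg_mem' := fun {a} ha y => by rw [ellipticPairing_neg_left, ha y, neg_zero]

/-- The group `R̄(W) = R(W) / rad` of virtual elliptic representations of `W`. -/
abbrev EllipticRepGroup (ρ : Representation ℝ W E) : Type 1 :=
  RepGroup W ⧸ ellipticRadical ρ

/-- The class `[V]` in `R̄(W)` of a representation. -/
def ellipticClass (ρ : Representation ℝ W E) (V : FDRep ℂ W) : EllipticRepGroup ρ :=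
  QuotientAddGroup.mk (repClass V)

theorem ellipticPairing_congr_left (ρ : Representation ℝ W E) {x x' : RepGroup W}
    (h : -x + x' ∈ ellipticRadical ρ) (y : RepGroup W) :
    ellipticPairing ρ x y = ellipticPairing ρ x' y := by
  have := h y
  rw [ellipticPairing_add_left, ellipticPairing_neg_left] at this
  linear_combination -this

/-- The elliptic pairing induced on `R̄(W)`. -/
def ellipticPairingBar (ρ : Representation ℝ W E) (x y : EllipticRepGroup ρ) : ℂ :=
  Quotient.liftOn₂' x y (ellipticPairing ρ) (fun a b a' b' ha hb => by
    rw [QuotientAddGroup.leftRel_apply] at ha hb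
    rw [ellipticPairing_congr_left ρ ha b, ellipticPairing_comm ρ a' b,
      ellipticPairing_congr_left ρ hb a', ellipticPairing_comm ρ b' a'])

theorem ellipticPairingBar_mk (ρ : Representation ℝ W E) (x y : RepGroup W) :
    ellipticPairingBar ρ (QuotientAddGroup.mk x) (QuotientAddGroup.mk y) =
      ellipticPairing ρ x y := rfl

end Elliptic

/-! ### The Weyl group of type `B_n` -/

/-- The Weyl group `W(B_n)`: the group `{±1}^n ⋊ S_n` of signed permutations, where `S_n`
permutes the `n` signs. -/
abbrev WeylB (n : ℕ) : Type :=
  (Fin n → ℤˣ) ⋊[mulAutArrow (G := Equiv.Perm (Fin n)) (A := Fin n) (M := ℤˣ)]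
    Equiv.Perm (Fin n)

instance WeylB.instFintype (n : ℕ) : Fintype (WeylB n) :=
  Fintype.ofEquiv _ SemidirectProduct.equivProd.symm

/-- The reflection representation of `W(B_n)` on `ℝ^n` by signed permutation matrices: the
element `(ε, π)` sends the basis vector `e_i` to `ε_{π(i)} e_{π(i)}`. -/
def WeylB.reflectionRep (n : ℕ) : Representation ℝ (WeylB n) (Fin n → ℝ) where
  toFun w :=
    { toFun := fun v i => ((w.left i : ℤ) : ℝ) * v (w.right⁻¹ i)
      map_add' := fun v v' => by ext i; simp [mul_add]
      map_smul' := fun c v => by ext i; simp; ring }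
  map_one' := by ext v i; simp
  map_mul' w w' := by
    refine LinearMap.ext fun v => funext fun i => ?_
    have h : (w * w').left i = w.left i * w'.left (w.right⁻¹ i) := rfl
    change (((w * w').left i : ℤ) : ℝ) * v ((w * w').right⁻¹ i) = (w.left i : ℤ) *
      ((w'.left (w.right⁻¹ i) : ℤ) * v (w'.right⁻¹ (w.right⁻¹ i)))
    rw [h]
    simp [mul_assoc]

/-! ### The irreducible representations `σ_λ` of `S_n` -/

/-- The Young diagram of a partition: the parts in decreasing order are the row lengths. -/
def partitionDiagram {n : ℕ} (l : n.Partition) : YoungDiagram :=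
  YoungDiagram.ofRowLens (l.parts.sort (· ≥ ·)) (l.parts.pairwise_sort (· ≥ ·)).sortedGE

theorem card_cellsOfRowLens (w : List ℕ) :
    (YoungDiagram.cellsOfRowLens w).card = w.sum := by
  induction w with
  | nil => simp [YoungDiagram.cellsOfRowLens]
  | cons a w ih =>
    rw [YoungDiagram.cellsOfRowLens, Finset.card_union_of_disjoint]
    · simp [ih]
    · rw [Finset.disjoint_left]
      rintro ⟨i, j⟩ h1 h2
      simp at h1 h2
      omega

theorem card_partitionDiagram {n : ℕ} (l : n.Partition) :
    (partitionDiagram l).cells.card = n := by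
  refine (card_cellsOfRowLens _).trans ?_
  rw [← Multiset.sum_coe, Multiset.sort_eq, l.parts_sum]

/-- A fixed tableau of shape `l`: the numbers `0, …, n - 1` placed bijectively in the cells
`(row, column)` of the diagram. -/
def tableau {n : ℕ} (l : n.Partition) : Fin n ≃ (partitionDiagram l).cells :=
  (Finset.equivFinOfCardEq (card_partitionDiagram l)).symm

/-- The sum of the permutations that preserve every row of the tableau. -/
def rowSymmetrizer {n : ℕ} (l : n.Partition) : MonoidAlgebra ℂ (Equiv.Perm (Fin n)) :=
  ∑ g : Equiv.Perm (Fin n) with ∀ k, (tableau l (g k)).1.1 = (tableau l k).1.1,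
    MonoidAlgebra.single g 1

/-- The signed sum of the permutations that preserve every column of the tableau. -/
def colAntisymmetrizer {n : ℕ} (l : n.Partition) : MonoidAlgebra ℂ (Equiv.Perm (Fin n)) :=
  ∑ g : Equiv.Perm (Fin n) with ∀ k, (tableau l (g k)).1.2 = (tableau l k).1.2,
    MonoidAlgebra.single g ((Equiv.Perm.sign g : ℤ) : ℂ)

/-- The Specht module: the left ideal `ℂ[S_n] c_λ` generated by the Young symmetrizer
`c_λ = a_λ b_λ`. -/
abbrev spechtModule {n : ℕ} (l : n.Partition) :
    Submodule (MonoidAlgebra ℂ (Equiv.Perm (Fin n))) (MonoidAlgebra ℂ (Equiv.Perm (Fin n))) :=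
  Submodule.span _ {rowSymmetrizer l * colAntisymmetrizer l}

instance spechtModule.instFinite {n : ℕ} (l : n.Partition) :
    Module.Finite ℂ (spechtModule l) :=
  haveI : Module.Finite ℂ (MonoidAlgebra ℂ (Equiv.Perm (Fin n))) :=
    Module.Finite.equiv (MonoidAlgebra.coeffLinearEquiv ℂ).symm
  Module.Finite.of_injective ((spechtModule l).subtype.restrictScalars ℂ)
    Subtype.val_injective

/-- The action of `S_n` on the Specht module by left multiplication. -/
def spechtRep {n : ℕ} (l : n.Partition) :
    Representation ℂ (Equiv.Perm (Fin n)) (spechtModule l) :=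
  Representation.ofModule' (spechtModule l)

/-- The irreducible representation `σ_λ` of `S_n`. -/
def sigmaRep {n : ℕ} (l : n.Partition) : FDRep ℂ (Equiv.Perm (Fin n)) :=
  FDRep.of (spechtRep l)

/-- The irreducible representation `λ × ∅` of `W(B_n)`: `σ_λ` inflated along the projection
`W(B_n) → S_n`, so that the sign changes act trivially. -/
def lambdaTimesEmpty {n : ℕ} (l : n.Partition) : FDRep ℂ (WeylB n) :=
  FDRep.of ((spechtRep l).comp SemidirectProduct.rightHom)

end

/-! The projection $W(B_n)\to S_n$ turns the elliptic pairing of inflated representations into the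
ordinary pairing of $S_n$: by row multilinearity of the determinant, $\det(1-w)$ summed over the
$2^n$ signed versions of a fixed permutation is $2^n$ (`WeylB.sum_det_one_sub`), which cancels
against $|W|=2^n\,n!$. Orthonormality of the $\lambda\times\emptyset$ thus reduces to that of the
$\sigma_\lambda$.

For generation, let $x\in R(W)$. An element with $\det(1-w)\ne0$ has only negative cycles, and two
such elements over the same permutation are conjugate (`WeylB.isConj_of_det_ne_zero`). Hence the
value of $x$ at such a $w$ is recovered from the $\det$-weighted sum of $x$ over the fibre of $w$.
If $x$ is orthogonal to every $\lambda\times\emptyset$, these fibre sums form a class function on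
$S_n$ orthogonal to every $\sigma_\lambda$, so they vanish and $x$ lies in the radical
(`mem_ellipticRadical_of_orthogonal`). As $\det(1-w)=\sum_k(-1)^k\operatorname{tr}\Lambda^k w$, the
numbers $\langle x,\lambda\times\emptyset\rangle$ are integers (`ellipticPairing_integral`), so
subtracting the orthogonal projection of $x$ stays inside $R(W)$.

The facts used about $S_n$ are derived from Young symmetrizers: Specht modules are simple and
orthonormal (`characterPairing_sigmaRep`), their characters detect class functions
(`classFunction_eq_zero`), and their classes generate $R(S_n)$ (`closure_range_sigmaRep`). -/

/-! ### Counting cells of Young diagrams -/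

/-- The number of cells of a Young diagram in its first `k` rows. -/
def YoungDiagram.cardTopRows (μ : YoungDiagram) (k : ℕ) : ℕ :=
  (μ.cells.filter fun c => c.1 < k).card

namespace YoungDiagram

theorem card_topRows_inter_col (μ : YoungDiagram) (k j : ℕ) :
    ((μ.cells.filter fun c => c.1 < k).filter fun c => c.2 = j).card = min k (μ.colLen j) := by
  have : ((μ.cells.filter fun c => c.1 < k).filter fun c => c.2 = j) =
      (Finset.range (min k (μ.colLen j))).image fun i => (i, j) := by
    ext ⟨a, b⟩
    simp only [Finset.mem_filter, mem_cells, mem_iff_lt_colLen, Finset.mem_image, Finset.mem_range,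
      Prod.mk.injEq, lt_min_iff]
    constructor
    · rintro ⟨⟨h1, h2⟩, rfl⟩
      exact ⟨a, ⟨h2, h1⟩, rfl, rfl⟩
    · rintro ⟨i, ⟨h1, h2⟩, rfl, rfl⟩
      exact ⟨⟨h2, h1⟩, rfl⟩
  rw [this, Finset.card_image_of_injective _ fun _ _ h => (Prod.ext_iff.1 h).1, Finset.card_range]

theorem cardTopRows_succ (μ : YoungDiagram) (k : ℕ) :
    μ.cardTopRows (k + 1) = μ.cardTopRows k + μ.rowLen k := by
  rw [rowLen_eq_card, cardTopRows, cardTopRows, ← Finset.card_union_of_disjoint]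
  · congr 1
    ext ⟨a, b⟩
    simp only [Finset.mem_filter, Finset.mem_union, mem_row_iff, mem_cells]
    constructor
    · rintro ⟨h1, h2⟩
      rcases Nat.lt_succ_iff_lt_or_eq.1 h2 with h | h
      · exact Or.inl ⟨h1, h⟩
      · exact Or.inr ⟨h1, h⟩
    · rintro (⟨h1, h2⟩ | ⟨h1, h2⟩)
      · exact ⟨h1, by omega⟩
      · exact ⟨h1, by omega⟩
  · rw [Finset.disjoint_left]
    rintro ⟨a, b⟩ h1 h2
    simp only [Finset.mem_filter, mem_row_iff] at h1 h2
    omega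

theorem eq_of_cardTopRows_eq {μ ν : YoungDiagram} (h : ∀ k, μ.cardTopRows k = ν.cardTopRows k) :
    μ = ν := by
  have hr : ∀ k, μ.rowLen k = ν.rowLen k := fun k => by
    have h1 := h (k + 1)
    rw [cardTopRows_succ, cardTopRows_succ, h k] at h1
    omega
  refine SetLike.ext fun c => ?_
  obtain ⟨i, j⟩ := c
  rw [mem_iff_lt_rowLen, mem_iff_lt_rowLen, hr]

theorem cardTopRows_eq_sum_min {ν : YoungDiagram} {N : ℕ} (hN : ∀ c ∈ ν.cells, c.2 < N) (k : ℕ) :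
    ν.cardTopRows k = ∑ j ∈ Finset.range N, min k (ν.colLen j) := by
  simp_rw [← card_topRows_inter_col]
  exact Finset.card_eq_sum_card_fiberwise fun c hc => by
    simpa using hN c (Finset.mem_filter.1 hc).1

theorem exists_col_lt (ν : YoungDiagram) : ∃ N, ∀ c ∈ ν.cells, c.2 < N :=
  ⟨ν.cells.sup Prod.snd + 1, fun _ hc => Nat.lt_succ_of_le (Finset.le_sup (f := Prod.snd) hc)⟩

/-! ### Dominance from pairs of fillings -/

section Fillings

variable {α : Type*} [Fintype α] {μ ν : YoungDiagram} (T : α ≃ μ.cells) (T' : α ≃ ν.cells)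

theorem card_filter_row_lt (k : ℕ) :
    (Finset.univ.filter fun a => (T a).1.1 < k).card = μ.cardTopRows k := by
  rw [cardTopRows]
  refine Finset.card_bij (fun a _ => (T a).1) ?_ ?_ ?_
  · intro a ha
    simpa using ha
  · intro a _ b _ h
    exact T.injective (Subtype.ext h)
  · intro c hc
    rw [Finset.mem_filter] at hc
    exact ⟨T.symm ⟨c, hc.1⟩, by simpa using hc.2, by simp⟩

theorem card_filter_col_eq (j : ℕ) :
    (Finset.univ.filter fun a => (T a).1.2 = j).card = μ.colLen j := by
  rw [colLen_eq_card]
  refine Finset.card_bij (fun a _ => (T a).1) ?_ ?_ ?_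
  · intro a ha
    simp only [Finset.mem_filter, Finset.mem_univ, true_and] at ha
    exact mem_col_iff.2 ⟨(T a).2, ha⟩
  · intro a _ b _ h
    exact T.injective (Subtype.ext h)
  · intro c hc
    rw [mem_col_iff] at hc
    exact ⟨T.symm ⟨c, hc.1⟩, by simpa using hc.2, by simp⟩

variable {T T'}

/-- Entries in one column of `T'` lie in distinct rows of `T`, so at most `k` of them fit in the
first `k` rows. -/
theorem card_filter_row_lt_col_eq_le
    (hinj : Function.Injective fun a => ((T a).1.1, (T' a).1.2)) (k j : ℕ) :
    ((Finset.univ.filter fun a => (T a).1.1 < k).filter fun a => (T' a).1.2 = j).card ≤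
      min k (ν.colLen j) := by
  refine le_min ?_ ?_
  · conv_rhs => rw [← Finset.card_range k]
    refine Finset.card_le_card_of_injOn (fun a => (T a).1.1) ?_ ?_
    · intro a ha
      simp only [Finset.coe_filter, Finset.mem_filter, Finset.mem_univ, true_and,
        Set.mem_ofPred_eq] at ha
      simpa using ha.1
    · intro a ha b hb h
      simp only [Finset.coe_filter, Finset.mem_filter, Finset.mem_univ, true_and,
        Set.mem_ofPred_eq] at ha hb
      exact hinj (Prod.ext h (ha.2.trans hb.2.symm))
  · rw [← card_filter_col_eq T']
    refine Finset.card_le_card fun a ha => ?_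
    simp only [Finset.mem_filter, Finset.mem_univ, true_and] at ha ⊢
    exact ha.2

theorem cardTopRows_eq_sum_fiber {N : ℕ} (hN : ∀ c ∈ ν.cells, c.2 < N) (k : ℕ) :
    μ.cardTopRows k = ∑ j ∈ Finset.range N,
      ((Finset.univ.filter fun a => (T a).1.1 < k).filter fun a => (T' a).1.2 = j).card := by
  rw [← card_filter_row_lt T]
  exact Finset.card_eq_sum_card_fiberwise fun a _ => by simpa using hN _ (T' a).2

/-- If no two entries lie in the same row of `T` and in the same column of `T'`, then the shape of
`T` is dominated by the shape of `T'`. -/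
theorem cardTopRows_le_of_injective
    (hinj : Function.Injective fun a => ((T a).1.1, (T' a).1.2)) (k : ℕ) :
    μ.cardTopRows k ≤ ν.cardTopRows k := by
  obtain ⟨N, hN⟩ := exists_col_lt ν
  rw [cardTopRows_eq_sum_fiber (T := T) hN, cardTopRows_eq_sum_min hN]
  exact Finset.sum_le_sum fun j _ => card_filter_row_lt_col_eq_le hinj k j

/-- If no two entries lie in the same row of `T` and in the same column of `T'`, and both have the
same shape, then the row in `T` and the column in `T'` of each entry give a cell of this shape. -/
theorem mem_of_injective {T T' : α ≃ μ.cells}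
    (hinj : Function.Injective fun a => ((T a).1.1, (T' a).1.2)) (a : α) :
    ((T a).1.1, (T' a).1.2) ∈ μ := by
  obtain ⟨N, hN⟩ := exists_col_lt μ
  set j := (T' a).1.2 with hj
  set k := μ.colLen j with hk
  have h1 := (cardTopRows_eq_sum_fiber (T := T) (T' := T') hN k).symm.trans (cardTopRows_eq_sum_min hN k)
  -- With equal shapes the columnwise bounds have equal totals, so each is an equality. For `k` the
  -- length of column `j`, this puts that whole column of `T'` in the first `k` rows of `T`.
  have h2 := (Finset.sum_eq_sum_iff_of_le
    fun j _ => card_filter_row_lt_col_eq_le hinj k j).1 h1 j (by simpa using hN _ (T' a).2)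
  have h3 : ((Finset.univ.filter fun a => (T a).1.1 < k).filter fun a => (T' a).1.2 = j) =
      Finset.univ.filter fun a => (T' a).1.2 = j := by
    refine Finset.eq_of_subset_of_card_le ?_ ?_
    · exact Finset.filter_subset_filter _ (Finset.subset_univ _)
    · rw [h2, card_filter_col_eq, min_eq_left hk.le]
  have h4 : a ∈ Finset.univ.filter fun a => (T' a).1.2 = j := by simp [hj]
  rw [← h3] at h4
  rw [mem_iff_lt_colLen]
  simpa using (Finset.mem_filter.1 (Finset.mem_filter.1 h4).1).2

end Fillings

end YoungDiagram

theorem partitionDiagram_injective (n : ℕ) :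
    Function.Injective (partitionDiagram : n.Partition → YoungDiagram) := by
  intro l m h
  have hl : ∀ l : n.Partition, (partitionDiagram l).rowLens = l.parts.sort (· ≥ ·) := fun l =>
    YoungDiagram.rowLens_ofRowLens_eq_self fun x hx => l.parts_pos (by simpa using hx)
  have h1 : l.parts.sort (· ≥ ·) = m.parts.sort (· ≥ ·) := by rw [← hl, ← hl, h]
  refine Nat.Partition.ext ?_
  rw [← Multiset.sort_eq l.parts (· ≥ ·), h1, Multiset.sort_eq]

/-- For distinct partitions `l`, `m`, one of them does not dominate the other. -/
theorem partitionDiagram_not_dominated {n : ℕ} {l m : n.Partition} (h : l ≠ m) :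
    (¬ ∀ k, (partitionDiagram l).cardTopRows k ≤ (partitionDiagram m).cardTopRows k) ∨
      ¬ ∀ k, (partitionDiagram m).cardTopRows k ≤ (partitionDiagram l).cardTopRows k := by
  by_contra! hc
  exact h (partitionDiagram_injective n
    (YoungDiagram.eq_of_cardTopRows_eq fun k => le_antisymm (hc.1 k) (hc.2 k)))

/-! ### Young symmetrizers -/

open MonoidAlgebra in
theorem rowSymmetrizer_mul_single {n : ℕ} (l : n.Partition) {p : Equiv.Perm (Fin n)}
    (hp : ∀ k, (tableau l (p k)).1.1 = (tableau l k).1.1) :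
    rowSymmetrizer l * single p 1 = rowSymmetrizer l := by
  simp only [rowSymmetrizer, Finset.sum_mul, single_mul_single, mul_one]
  refine Finset.sum_equiv (Equiv.mulRight p) (fun g => ?_) (fun g _ => rfl)
  simp only [Finset.mem_filter, Finset.mem_univ, true_and, Equiv.coe_mulRight, Equiv.Perm.mul_apply]
  constructor
  · intro h k
    rw [h, hp]
  · intro h k
    have h1 := h (p⁻¹ k)
    have h2 := hp (p⁻¹ k)
    have e : p (p⁻¹ k) = k := by simp
    rw [e] at h1 h2
    exact h1.trans h2.symm

open MonoidAlgebra in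
theorem single_mul_colAntisymmetrizer {n : ℕ} (l : n.Partition) {q : Equiv.Perm (Fin n)}
    (hq : ∀ k, (tableau l (q k)).1.2 = (tableau l k).1.2) :
    single q 1 * colAntisymmetrizer l =
      ((Equiv.Perm.sign q : ℤ) : ℂ) • colAntisymmetrizer l := by
  simp only [colAntisymmetrizer, Finset.mul_sum, single_mul_single, one_mul, Finset.smul_sum,
    smul_single, smul_eq_mul]
  refine Finset.sum_equiv (Equiv.mulLeft q) (fun g => ?_) (fun g _ => ?_)
  · simp only [Finset.mem_filter, Finset.mem_univ, true_and, Equiv.coe_mulLeft,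
      Equiv.Perm.mul_apply, hq]
  · have h : (((Equiv.Perm.sign q : ℤ) : ℂ)) * ((Equiv.Perm.sign q : ℤ) : ℂ) = 1 := by
      rw [← Int.cast_mul, ← Units.val_mul, Int.units_mul_self]
      simp
    simp [← mul_assoc, h]

-- The transposition of `i` and `j` is absorbed by the row symmetrizer; moved past `g` it becomes a
-- column transposition, which contributes the sign `-1`. The product therefore equals its own
-- negative.
open MonoidAlgebra in
theorem rowSymmetrizer_mul_single_mul_colAntisymmetrizer_eq_zero {n : ℕ} {l m : n.Partition}
    {g : Equiv.Perm (Fin n)} {i j : Fin n} (hij : i ≠ j)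
    (hr : (tableau l i).1.1 = (tableau l j).1.1)
    (hc : (tableau m (g⁻¹ i)).1.2 = (tableau m (g⁻¹ j)).1.2) :
    rowSymmetrizer l * single g 1 * colAntisymmetrizer m = 0 := by
  have hp : ∀ k, (tableau l (Equiv.swap i j k)).1.1 = (tableau l k).1.1 := fun k => by
    rw [Equiv.swap_apply_def]
    split_ifs with h1 h2
    · rw [h1, hr]
    · rw [h2, hr]
    · rfl
  have hq : ∀ k, (tableau m (Equiv.swap (g⁻¹ i) (g⁻¹ j) k)).1.2 = (tableau m k).1.2 := fun k => by
    rw [Equiv.swap_apply_def]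
    split_ifs with h1 h2
    · rw [h1, hc]
    · rw [h2, hc]
    · rfl
  have hs : Equiv.swap i j * g = g * Equiv.swap (g⁻¹ i) (g⁻¹ j) := by
    rw [Equiv.mul_swap_eq_swap_mul]
    simp
  have key : rowSymmetrizer l * single g 1 * colAntisymmetrizer m =
      -(rowSymmetrizer l * single g 1 * colAntisymmetrizer m) := by
    conv_lhs => rw [← rowSymmetrizer_mul_single l hp, mul_assoc (rowSymmetrizer l),
      single_mul_single, hs, mul_one, ← mul_one (1 : ℂ), ← single_mul_single, mul_assoc, mul_assoc,
      single_mul_colAntisymmetrizer m hq]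
    rw [Equiv.Perm.sign_swap (by simpa using hij)]
    simp [mul_assoc]
  have h2 : (2 : ℂ) • (rowSymmetrizer l * single g 1 * colAntisymmetrizer m) = 0 := by
    rw [two_smul]
    exact eq_neg_iff_add_eq_zero.1 key
  exact (smul_eq_zero.1 h2).resolve_left two_ne_zero

open MonoidAlgebra in
/-- `a_l A b_m = 0` unless `l` is dominated by `m`. -/
theorem rowSymmetrizer_mul_mul_colAntisymmetrizer_eq_zero {n : ℕ} {l m : n.Partition}
    (h : ¬ ∀ k, (partitionDiagram l).cardTopRows k ≤ (partitionDiagram m).cardTopRows k)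
    (x : MonoidAlgebra ℂ (Equiv.Perm (Fin n))) :
    rowSymmetrizer l * x * colAntisymmetrizer m = 0 := by
  induction x using MonoidAlgebra.induction_linear with
  | zero => simp
  | add x y hx hy => rw [mul_add, add_mul, hx, hy, add_zero]
  | single g r =>
    have hn : ¬ Function.Injective fun k => ((tableau l k).1.1, (tableau m (g⁻¹ k)).1.2) :=
      fun hi => h (YoungDiagram.cardTopRows_le_of_injective (T := tableau l)
        (T' := g⁻¹.trans (tableau m)) hi)
    simp only [Function.Injective, not_forall] at hn
    obtain ⟨i, j, hij, hne⟩ := hn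
    have := rowSymmetrizer_mul_single_mul_colAntisymmetrizer_eq_zero hne
      (Prod.ext_iff.1 hij).1 (Prod.ext_iff.1 hij).2
    have hr : (single g r : MonoidAlgebra ℂ (Equiv.Perm (Fin n))) = r • single g 1 := by
      simp [smul_single]
    rw [hr, mul_smul_comm, smul_mul_assoc, this, smul_zero]

/-- The Young symmetrizer. -/
noncomputable def youngSymmetrizer {n : ℕ} (l : n.Partition) :
    MonoidAlgebra ℂ (Equiv.Perm (Fin n)) :=
  rowSymmetrizer l * colAntisymmetrizer l

/-- If no two entries in the same row of the tableau lie in the same column of the tableau moved by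
`g`, then `g` is a product of a row and a column permutation. -/
theorem exists_row_mul_col_of_injective {n : ℕ} {l : n.Partition} {g : Equiv.Perm (Fin n)}
    (hi : Function.Injective fun k => ((tableau l k).1.1, (tableau l (g⁻¹ k)).1.2)) :
    ∃ p q : Equiv.Perm (Fin n), (∀ k, (tableau l (p k)).1.1 = (tableau l k).1.1) ∧
      (∀ k, (tableau l (q k)).1.2 = (tableau l k).1.2) ∧ g = p * q := by
  have hmem := YoungDiagram.mem_of_injective (T := tableau l) (T' := g⁻¹.trans (tableau l)) hi
  -- Slide each entry within its row to the column it occupies in the tableau moved by `g`. This row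
  -- permutation `p` makes `p * g` preserve columns.
  let f : Fin n → Fin n := fun k => (tableau l).symm ⟨_, hmem k⟩
  have hf : ∀ k, (tableau l (f k)).1 = ((tableau l k).1.1, (tableau l (g⁻¹ k)).1.2) := fun k => by
    simp only [f, Equiv.apply_symm_apply]
    rfl
  have hinj : Function.Injective f := fun a b hab => hi (by
    dsimp only
    rw [← hf, ← hf, hab])
  let p : Equiv.Perm (Fin n) := Equiv.ofBijective f (Finite.injective_iff_bijective.1 hinj)
  have hp : ∀ k, (tableau l (p k)).1 = ((tableau l k).1.1, (tableau l (g⁻¹ k)).1.2) := hf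
  refine ⟨p⁻¹, p * g, fun k => ?_, fun k => ?_, by group⟩
  · have := hp (p⁻¹ k)
    rw [← Equiv.Perm.mul_apply, mul_inv_cancel, Equiv.Perm.one_apply] at this
    rw [this]
  · rw [Equiv.Perm.mul_apply, hp, ← Equiv.Perm.mul_apply, inv_mul_cancel, Equiv.Perm.one_apply]

open MonoidAlgebra in
/-- `a_l A b_l` is spanned by the Young symmetrizer. -/
theorem exists_rowSymmetrizer_mul_mul_colAntisymmetrizer {n : ℕ} (l : n.Partition)
    (x : MonoidAlgebra ℂ (Equiv.Perm (Fin n))) :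
    ∃ t : ℂ, rowSymmetrizer l * x * colAntisymmetrizer l = t • youngSymmetrizer l := by
  induction x using MonoidAlgebra.induction_linear with
  | zero => exact ⟨0, by simp⟩
  | add x y hx hy =>
    obtain ⟨t, ht⟩ := hx
    obtain ⟨s, hs⟩ := hy
    exact ⟨t + s, by rw [mul_add, add_mul, ht, hs, add_smul]⟩
  | single g r =>
    have hr : (single g r : MonoidAlgebra ℂ (Equiv.Perm (Fin n))) = r • single g 1 := by
      simp [smul_single]
    by_cases hi : Function.Injective fun k => ((tableau l k).1.1, (tableau l (g⁻¹ k)).1.2)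
    · obtain ⟨p, q, hp, hq, rfl⟩ := exists_row_mul_col_of_injective hi
      refine ⟨r * ((Equiv.Perm.sign q : ℤ) : ℂ), ?_⟩
      rw [hr, ← mul_one (1 : ℂ), ← single_mul_single, mul_smul_comm, smul_mul_assoc, ← mul_assoc,
        rowSymmetrizer_mul_single l hp, mul_assoc, single_mul_colAntisymmetrizer l hq,
        mul_smul_comm, smul_smul, youngSymmetrizer]
    · simp only [Function.Injective, not_forall] at hi
      obtain ⟨i, j, hij, hne⟩ := hi
      refine ⟨0, ?_⟩
      rw [hr, mul_smul_comm, smul_mul_assoc,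
        rowSymmetrizer_mul_single_mul_colAntisymmetrizer_eq_zero hne
          (Prod.ext_iff.1 hij).1 (Prod.ext_iff.1 hij).2, smul_zero, zero_smul]

theorem exists_youngSymmetrizer_mul_mul {n : ℕ} (l : n.Partition)
    (x : MonoidAlgebra ℂ (Equiv.Perm (Fin n))) :
    ∃ t : ℂ, youngSymmetrizer l * x * youngSymmetrizer l = t • youngSymmetrizer l := by
  obtain ⟨t, ht⟩ := exists_rowSymmetrizer_mul_mul_colAntisymmetrizer l
    (colAntisymmetrizer l * x * rowSymmetrizer l)
  exact ⟨t, by rw [← ht, youngSymmetrizer]; simp only [mul_assoc]⟩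

theorem youngSymmetrizer_mul_mul_eq_zero {n : ℕ} {l m : n.Partition}
    (h : ¬ ∀ k, (partitionDiagram l).cardTopRows k ≤ (partitionDiagram m).cardTopRows k)
    (x : MonoidAlgebra ℂ (Equiv.Perm (Fin n))) :
    youngSymmetrizer l * x * youngSymmetrizer m = 0 := by
  rw [← rowSymmetrizer_mul_mul_colAntisymmetrizer_eq_zero h
    (colAntisymmetrizer l * x * rowSymmetrizer m), youngSymmetrizer, youngSymmetrizer]
  simp only [mul_assoc]

-- A permutation preserving both rows and columns is trivial, so the identity arises only as `1 *
-- 1`.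
open MonoidAlgebra in
theorem youngSymmetrizer_coeff_one {n : ℕ} (l : n.Partition) :
    (youngSymmetrizer l).coeff 1 = 1 := by
  rw [youngSymmetrizer, rowSymmetrizer, colAntisymmetrizer, Finset.sum_mul_sum, coeff_sum,
    Finsupp.finsetSum_apply, Finset.sum_eq_single_of_mem (1 : Equiv.Perm (Fin n)) (by simp)]
  · rw [coeff_sum, Finsupp.finsetSum_apply,
      Finset.sum_eq_single_of_mem (1 : Equiv.Perm (Fin n)) (by simp)]
    · simp [single_mul_single]
    · intro q _ hq
      simp [single_mul_single, coeff_single, hq]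
  · intro p hp hp1
    rw [coeff_sum, Finsupp.finsetSum_apply]
    refine Finset.sum_eq_zero fun q hq => ?_
    simp only [Finset.mem_filter, Finset.mem_univ, true_and] at hp hq
    rw [single_mul_single, coeff_single, Finsupp.single_apply, if_neg]
    intro hpq
    refine hp1 (Equiv.ext fun k => (tableau l).injective (Subtype.ext (Prod.ext (hp k) ?_)))
    have hq' := hq (p k)
    rw [← Equiv.Perm.mul_apply, mul_eq_one_iff_eq_inv'.1 hpq, inv_mul_cancel] at hq'
    simpa using hq'.symm

open MonoidAlgebra in
theorem trace_mulRight_monoidAlgebra {G : Type*} [Group G] [Fintype G] [DecidableEq G]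
    (c : MonoidAlgebra ℂ G) :
    LinearMap.trace ℂ _ (LinearMap.mulRight ℂ c) = Fintype.card G * c.coeff 1 := by
  let b : Module.Basis G ℂ (MonoidAlgebra ℂ G) := .ofRepr (coeffLinearEquiv ℂ)
  rw [LinearMap.trace_eq_matrix_trace ℂ b, Matrix.trace]
  have h : ∀ g : G, (LinearMap.toMatrix b b (LinearMap.mulRight ℂ c)).diag g = c.coeff 1 := by
    intro g
    rw [Matrix.diag_apply, LinearMap.toMatrix_apply]
    have hb : b g = single g 1 := rfl
    rw [hb, LinearMap.mulRight_apply]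
    change (single g 1 * c).coeff g = _
    simp [coeff_single_mul_apply]
  rw [Finset.sum_congr rfl fun g _ => h g]
  simp

theorem youngSymmetrizer_ne_zero {n : ℕ} (l : n.Partition) : youngSymmetrizer l ≠ 0 := fun h => by
  have := youngSymmetrizer_coeff_one l
  simp [h] at this

/-- If the scalar were zero, right multiplication by the symmetrizer would be nilpotent; but its
trace is `n!` times the coefficient at the identity, which is `1`. -/
theorem exists_youngSymmetrizer_mul_self {n : ℕ} (l : n.Partition) :
    ∃ t : ℂ, t ≠ 0 ∧ youngSymmetrizer l * youngSymmetrizer l = t • youngSymmetrizer l := by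
  obtain ⟨t, ht⟩ := exists_youngSymmetrizer_mul_mul l 1
  rw [mul_one] at ht
  refine ⟨t, ?_, ht⟩
  rintro rfl
  have hn : IsNilpotent (LinearMap.mulRight ℂ (youngSymmetrizer l)) :=
    ⟨2, LinearMap.ext fun x => by simp [pow_two, mul_assoc, ht]⟩
  have : Module.Finite ℂ (MonoidAlgebra ℂ (Equiv.Perm (Fin n))) :=
    Module.Finite.equiv (MonoidAlgebra.coeffLinearEquiv ℂ).symm
  have h := (LinearMap.isNilpotent_trace_of_isNilpotent hn).eq_zero
  rw [trace_mulRight_monoidAlgebra, youngSymmetrizer_coeff_one, mul_one] at h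
  exact Fintype.card_ne_zero (Nat.cast_eq_zero.1 h)

/-! ### Specht modules -/

section Specht

variable {n : ℕ}

theorem spechtRep_apply (l : n.Partition) (g : Equiv.Perm (Fin n)) (x : spechtModule l) :
    spechtRep l g x = (MonoidAlgebra.single g 1 : MonoidAlgebra ℂ (Equiv.Perm (Fin n))) • x :=
  rfl

/-- The Young symmetrizer as an element of the Specht module. -/
noncomputable def spechtGenerator (l : n.Partition) : spechtModule l :=
  ⟨youngSymmetrizer l, Submodule.mem_span_singleton_self _⟩

theorem exists_smul_spechtGenerator (l : n.Partition) (x : spechtModule l) :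
    ∃ a : MonoidAlgebra ℂ (Equiv.Perm (Fin n)), x = a • spechtGenerator l := by
  obtain ⟨a, ha⟩ := Submodule.mem_span_singleton.1 x.2
  exact ⟨a, Subtype.ext ha.symm⟩

theorem spechtGenerator_ne_zero (l : n.Partition) : spechtGenerator l ≠ 0 := fun h =>
  youngSymmetrizer_ne_zero l (congrArg Subtype.val h)

/-- An intertwining map between Specht modules is linear over the group algebra. -/
theorem spechtRep_intertwiningMap_smul {l m : n.Partition}
    (f : (spechtRep l).IntertwiningMap (spechtRep m))
    (a : MonoidAlgebra ℂ (Equiv.Perm (Fin n))) (x : spechtModule l) : f (a • x) = a • f x := by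
  induction a using MonoidAlgebra.induction_linear with
  | zero => rw [zero_smul, zero_smul]; exact f.toLinearMap.map_zero
  | add a b ha hb => rw [add_smul, add_smul, ← ha, ← hb]; exact f.toLinearMap.map_add _ _
  | single g r =>
    have hr : (MonoidAlgebra.single g r : MonoidAlgebra ℂ (Equiv.Perm (Fin n))) =
        r • MonoidAlgebra.single g 1 := by
      simp [MonoidAlgebra.smul_single]
    rw [hr, smul_assoc, smul_assoc, ← spechtRep_apply, ← spechtRep_apply, ← f.isIntertwining]
    exact f.toLinearMap.map_smul _ _

/-- Up to a nonzero scalar the generator is `c_l * c_l`, so its image is a multiple of some `c_l * a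
* c_m`, which vanishes. -/
theorem spechtRep_intertwiningMap_eq_zero {l m : n.Partition}
    (h : ¬ ∀ k, (partitionDiagram l).cardTopRows k ≤ (partitionDiagram m).cardTopRows k)
    (f : (spechtRep l).IntertwiningMap (spechtRep m)) : f = 0 := by
  obtain ⟨t, ht, hl⟩ := exists_youngSymmetrizer_mul_self l
  obtain ⟨a, ha⟩ := exists_smul_spechtGenerator m (f (spechtGenerator l))
  have h0 : t • f (spechtGenerator l) = 0 := by
    have h1 : t • spechtGenerator l = youngSymmetrizer l • spechtGenerator l :=
      Subtype.ext hl.symm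
    have h2 : f (t • spechtGenerator l) = t • f (spechtGenerator l) := f.toLinearMap.map_smul _ _
    rw [← h2, h1, spechtRep_intertwiningMap_smul, ha]
    refine Subtype.ext ?_
    change youngSymmetrizer l * (a * youngSymmetrizer m) = 0
    rw [← mul_assoc, youngSymmetrizer_mul_mul_eq_zero h]
  have h3 := (smul_eq_zero.1 h0).resolve_left ht
  refine Representation.IntertwiningMap.ext (LinearMap.ext fun x => ?_)
  obtain ⟨b, rfl⟩ := exists_smul_spechtGenerator l x
  change f (b • spechtGenerator l) = 0
  rw [spechtRep_intertwiningMap_smul, h3, smul_zero]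

/-- The generator `c` goes to a multiple of some `c * a * c`, hence to a scalar multiple of itself.
-/
theorem finrank_spechtRep_intertwiningMap_self (l : n.Partition) :
    Module.finrank ℂ ((spechtRep l).IntertwiningMap (spechtRep l)) = 1 := by
  refine finrank_eq_one (1 : (spechtRep l).IntertwiningMap (spechtRep l)) ?_ fun f => ?_
  · intro h
    have h1 : (1 : (spechtRep l).IntertwiningMap (spechtRep l)) (spechtGenerator l) = 0 := by
      rw [h]; rfl
    exact spechtGenerator_ne_zero l h1
  · obtain ⟨t, ht, hl⟩ := exists_youngSymmetrizer_mul_self l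
    obtain ⟨a, ha⟩ := exists_smul_spechtGenerator l (f (spechtGenerator l))
    obtain ⟨s, hs⟩ := exists_youngSymmetrizer_mul_mul l a
    have h0 : t • f (spechtGenerator l) = s • spechtGenerator l := by
      have h1 : t • spechtGenerator l = youngSymmetrizer l • spechtGenerator l :=
        Subtype.ext hl.symm
      have h2 : f (t • spechtGenerator l) = t • f (spechtGenerator l) := f.toLinearMap.map_smul _ _
      rw [← h2, h1, spechtRep_intertwiningMap_smul, ha]
      refine Subtype.ext ?_
      change youngSymmetrizer l * (a * youngSymmetrizer l) = s • youngSymmetrizer l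
      rw [← mul_assoc, hs]
    have h3 : f (spechtGenerator l) = (t⁻¹ * s) • spechtGenerator l := by
      rw [mul_smul, ← h0, inv_smul_smul₀ ht]
    refine ⟨t⁻¹ * s, Representation.IntertwiningMap.ext (LinearMap.ext fun x => ?_)⟩
    obtain ⟨b, rfl⟩ := exists_smul_spechtGenerator l x
    change (t⁻¹ * s) • (b • spechtGenerator l) = f (b • spechtGenerator l)
    rw [spechtRep_intertwiningMap_smul, h3, smul_comm]

/-- The Specht module is simple. -/
theorem spechtGenerator_mem_of_ne_bot {l : n.Partition}
    {N : Submodule (MonoidAlgebra ℂ (Equiv.Perm (Fin n))) (spechtModule l)} (hN : N ≠ ⊥) :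
    spechtGenerator l ∈ N := by
  by_contra hc
  -- Applying `c` to `a * c` gives a multiple `s • c`; a nonzero `s` would put the generator in `N`.
  have h0 : ∀ x ∈ N, youngSymmetrizer l • x = 0 := fun x hx => by
    obtain ⟨a, rfl⟩ := exists_smul_spechtGenerator l x
    obtain ⟨s, hs⟩ := exists_youngSymmetrizer_mul_mul l a
    have h1 : youngSymmetrizer l • a • spechtGenerator l = s • spechtGenerator l := by
      refine Subtype.ext ?_
      change youngSymmetrizer l * (a * youngSymmetrizer l) = s • youngSymmetrizer l
      rw [← mul_assoc, hs]
    rcases eq_or_ne s 0 with rfl | hs0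
    · rw [h1, zero_smul]
    · refine absurd ?_ hc
      have h2 : s • spechtGenerator l ∈ N := h1 ▸ N.smul_mem _ hx
      have h3 : spechtGenerator l =
          (algebraMap ℂ (MonoidAlgebra ℂ (Equiv.Perm (Fin n))) s⁻¹) • s • spechtGenerator l := by
        rw [algebraMap_smul, inv_smul_smul₀ hs0]
      rw [h3]
      exact N.smul_mem _ h2
  have hz : ∀ x ∈ N, ∀ y ∈ N, (x : MonoidAlgebra ℂ (Equiv.Perm (Fin n))) * y = 0 := by
    intro x _ y hy
    obtain ⟨a, rfl⟩ := exists_smul_spechtGenerator l x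
    have := congrArg Subtype.val (h0 y hy)
    change youngSymmetrizer l * y = 0 at this
    change a * youngSymmetrizer l * y = 0
    rw [mul_assoc, this, mul_zero]
  let I : Ideal (MonoidAlgebra ℂ (Equiv.Perm (Fin n))) := N.map (spechtModule l).subtype
  have : NeZero (Nat.card (Equiv.Perm (Fin n)) : ℂ) := ⟨Nat.cast_ne_zero.2 Nat.card_pos.ne'⟩
  -- By Maschke the left ideal is generated by an idempotent, which is zero because `N * N = 0`.
  obtain ⟨e, he, heI⟩ := IsSemisimpleRing.ideal_eq_span_idempotent I
  have hmem : e ∈ I := heI ▸ Ideal.mem_span_singleton_self e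
  obtain ⟨e', he', rfl⟩ := hmem
  have h1 : (spechtModule l).subtype e' = 0 := by
    rw [← he.eq]
    exact hz e' he' e' he'
  apply hN
  rw [eq_bot_iff]
  intro x hx
  have hx' : (spechtModule l).subtype x ∈ I := ⟨x, hx, rfl⟩
  rw [heI, h1, Ideal.span_singleton_zero, Ideal.mem_bot] at hx'
  exact Subtype.ext hx'

/-- The kernel is a submodule; were it nonzero, it would contain the generator and `f` would vanish.
-/
theorem spechtRep_intertwiningMap_injective {l : n.Partition} {V : Type*} [AddCommGroup V]
    [Module ℂ V] {ρ : Representation ℂ (Equiv.Perm (Fin n)) V}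
    {f : (spechtRep l).IntertwiningMap ρ} (hf : f ≠ 0) : Function.Injective f := by
  let N : Submodule (MonoidAlgebra ℂ (Equiv.Perm (Fin n))) (spechtModule l) :=
    { carrier := {x | f x = 0}
      zero_mem' := f.toLinearMap.map_zero
      add_mem' := fun {a b} ha hb => by
        have : f (a + b) = f a + f b := f.toLinearMap.map_add _ _
        rw [Set.mem_ofPred_eq] at ha hb ⊢
        rw [this, ha, hb, add_zero]
      smul_mem' := fun a x hx => by
        rw [Set.mem_ofPred_eq] at hx ⊢
        induction a using MonoidAlgebra.induction_linear with
        | zero => rw [zero_smul]; exact f.toLinearMap.map_zero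
        | add a b ha hb =>
          rw [add_smul, ← add_zero (0 : V)]
          nth_rw 1 [← ha]
          rw [← hb]
          exact f.toLinearMap.map_add _ _
        | single g r =>
          have hr : (MonoidAlgebra.single g r : MonoidAlgebra ℂ (Equiv.Perm (Fin n))) =
              r • MonoidAlgebra.single g 1 := by
            simp [MonoidAlgebra.smul_single]
          have h1 : f (r • spechtRep l g x) = r • f (spechtRep l g x) := f.toLinearMap.map_smul _ _
          rw [hr, smul_assoc, ← spechtRep_apply, h1, f.isIntertwining, hx, map_zero, smul_zero] }
  have hN : N = ⊥ := by
    by_contra hN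
    have hg := spechtGenerator_mem_of_ne_bot hN
    apply hf
    refine Representation.IntertwiningMap.ext (LinearMap.ext fun x => ?_)
    obtain ⟨b, rfl⟩ := exists_smul_spechtGenerator l x
    exact N.smul_mem b hg
  refine (injective_iff_map_eq_zero f.toLinearMap).2 fun x hx => ?_
  have : x ∈ N := hx
  rwa [hN, Submodule.mem_bot] at this

end Specht

/-! ### Characters of the symmetric group -/

section SymmetricCharacters

variable {n : ℕ}

theorem Equiv.Perm.isConj_inv {α : Type*} [Fintype α] [DecidableEq α] (g : Equiv.Perm α) :
    IsConj g g⁻¹ :=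
  Equiv.Perm.isConj_iff_cycleType_eq.2 (Equiv.Perm.cycleType_inv g).symm

theorem virtualCharacter_conj {G : Type} [Group G] (x : RepGroup G) (g h : G) :
    virtualCharacter G x (h * g * h⁻¹) = virtualCharacter G x g := by
  obtain ⟨x, rfl⟩ := QuotientAddGroup.mk_surjective x
  induction x using FreeAbelianGroup.induction_on with
  | zero => simp
  | of V =>
    change virtualCharacter G (repClass V) _ = virtualCharacter G (repClass V) _
    rw [virtualCharacter_repClass, FDRep.char_conj]
  | neg x hx => simpa using hx
  | add x y hx hy => simp [hx, hy]

theorem virtualCharacter_isConj {G : Type} [Group G] (x : RepGroup G) {g h : G} (hgh : IsConj g h) :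
    virtualCharacter G x g = virtualCharacter G x h := by
  obtain ⟨c, rfl⟩ := isConj_iff.1 hgh
  rw [virtualCharacter_conj]

/-- Reconciles the inverse in the character pairing with its absence from the elliptic pairing. -/
theorem virtualCharacter_perm_inv (x : RepGroup (Equiv.Perm (Fin n))) (g : Equiv.Perm (Fin n)) :
    virtualCharacter _ x g⁻¹ = virtualCharacter _ x g :=
  (virtualCharacter_isConj x g.isConj_inv).symm

theorem characterPairing_comm_perm (x y : RepGroup (Equiv.Perm (Fin n))) :
    characterPairing x y = characterPairing y x := by
  simp only [characterPairing, virtualCharacter_perm_inv, mul_comm (virtualCharacter _ x _)]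

theorem characterPairing_repClass {G : Type} [Group G] [Fintype G] (V W : FDRep ℂ G) :
    characterPairing (repClass V) (repClass W) =
      Module.finrank ℂ (Representation.IntertwiningMap (V := W) (W := V) W.ρ V.ρ) := by
  have : Invertible (Nat.card G : ℂ) := invertibleOfNonzero (Nat.cast_ne_zero.2 Nat.card_pos.ne')
  rw [← Representation.card_inv_mul_sum_char_mul_char_eq_finrank, characterPairing,
    Nat.card_eq_fintype_card, virtualCharacter_repClass, virtualCharacter_repClass]
  rfl

/-- The pairing is the dimension of a Hom space. For distinct partitions dominance fails in at least
one direction, which kills Hom in that direction; symmetry of the pairing covers the other. -/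
theorem characterPairing_sigmaRep (l m : n.Partition) :
    characterPairing (repClass (sigmaRep l)) (repClass (sigmaRep m)) = if l = m then 1 else 0 := by
  have key : ∀ l m : n.Partition,
      (¬ ∀ k, (partitionDiagram l).cardTopRows k ≤ (partitionDiagram m).cardTopRows k) →
      characterPairing (repClass (sigmaRep m)) (repClass (sigmaRep l)) = 0 := fun l m h => by
    rw [characterPairing_repClass, Nat.cast_eq_zero]
    have : Subsingleton ((spechtRep l).IntertwiningMap (spechtRep m)) :=
      ⟨fun f g => (spechtRep_intertwiningMap_eq_zero h f).trans
        (spechtRep_intertwiningMap_eq_zero h g).symm⟩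
    exact Module.finrank_zero_of_subsingleton (R := ℂ)
      (M := (spechtRep l).IntertwiningMap (spechtRep m))
  split_ifs with h
  · subst h
    rw [characterPairing_repClass]
    exact_mod_cast finrank_spechtRep_intertwiningMap_self l
  · rcases partitionDiagram_not_dominated h with h | h
    · rw [characterPairing_comm_perm, key l m h]
    · rw [key m l h]

/-- The partition of `n` given by the cycle lengths of a permutation. -/
def permPartition (g : Equiv.Perm (Fin n)) : n.Partition :=
  (Fintype.card_fin n) ▸ g.partition

theorem isConj_of_permPartition_eq {g h : Equiv.Perm (Fin n)}
    (hgh : permPartition g = permPartition h) : IsConj g h := by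
  rw [Equiv.Perm.partition_eq_of_isConj]
  have : Function.Injective fun l : (Fintype.card (Fin n)).Partition =>
      ((Fintype.card_fin n) ▸ l : n.Partition) := by
    generalize_proofs pf
    revert pf
    generalize Fintype.card (Fin n) = N
    rintro rfl
    exact fun _ _ h => h
  exact this hgh

/-- Cycle type separates classes. Only this inequality is needed: orthonormality of the Specht
characters supplies the reverse one. -/
theorem card_conjClasses_perm_le :
    Nat.card (ConjClasses (Equiv.Perm (Fin n))) ≤ Fintype.card n.Partition := by
  rw [← Nat.card_eq_fintype_card]
  refine Nat.card_le_card_of_injective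
    (fun c : ConjClasses (Equiv.Perm (Fin n)) => permPartition (Quotient.out c)) fun c d h => ?_
  have h1 := isConj_of_permPartition_eq h
  rw [← Quotient.out_eq c, ← Quotient.out_eq d]
  exact Quotient.sound h1

/-- A class function on `S_n` that is orthogonal to the characters of the Specht modules is zero. -/
theorem classFunction_eq_zero {F : Equiv.Perm (Fin n) → ℂ}
    (hF : ∀ g h, IsConj g h → F g = F h)
    (h0 : ∀ l : n.Partition, ∑ g, F g * virtualCharacter _ (repClass (sigmaRep l)) g = 0) :
    F = 0 := by
  classical
  have := Fintype.ofFinite (ConjClasses (Equiv.Perm (Fin n)))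
  let Φ : (ConjClasses (Equiv.Perm (Fin n)) → ℂ) →ₗ[ℂ] (n.Partition → ℂ) :=
    { toFun := fun F l =>
        ∑ g, F (ConjClasses.mk g) * virtualCharacter _ (repClass (sigmaRep l)) g
      map_add' := fun F F' => by
        ext l
        simp [add_mul, Finset.sum_add_distrib]
      map_smul' := fun c F => by
        ext l
        simp [mul_assoc, Finset.mul_sum] }
  have hc : (Fintype.card (Equiv.Perm (Fin n)) : ℂ) ≠ 0 := Nat.cast_ne_zero.2 Fintype.card_ne_zero
  have hsurj : Function.Surjective Φ := by
    rw [← LinearMap.range_eq_top, eq_top_iff, ← (Pi.basisFun ℂ n.Partition).span_eq,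
      Submodule.span_le]
    rintro _ ⟨m, rfl⟩
    -- By orthonormality the character of $\sigma_m$ divided by $n!$ maps to the `m`-th basis
    -- vector.
    refine ⟨fun c => (Fintype.card (Equiv.Perm (Fin n)) : ℂ)⁻¹ *
      Quotient.lift (virtualCharacter _ (repClass (sigmaRep m)))
        (fun _ _ h => virtualCharacter_isConj _ h) c, ?_⟩
    ext l
    have := characterPairing_sigmaRep m l
    simp only [characterPairing, virtualCharacter_perm_inv, Finset.mul_sum] at this
    rw [Pi.basisFun_apply, Pi.single_apply]
    simp_rw [eq_comm (a := l)]
    rw [← this]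
    exact Finset.sum_congr rfl fun g _ => mul_assoc _ _ _
  have hdim : Module.finrank ℂ (ConjClasses (Equiv.Perm (Fin n)) → ℂ) =
      Module.finrank ℂ (n.Partition → ℂ) := by
    refine le_antisymm ?_ (LinearMap.finrank_le_finrank_of_surjective hsurj)
    rw [Module.finrank_fintype_fun_eq_card, Module.finrank_fintype_fun_eq_card,
      ← Nat.card_eq_fintype_card]
    exact card_conjClasses_perm_le
  have hinj := (LinearMap.injective_iff_surjective_of_finrank_eq_finrank hdim).2 hsurj
  have h1 : Φ (Quotient.lift F hF) = 0 := funext h0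
  have h2 := (injective_iff_map_eq_zero Φ).1 hinj _ h1
  exact funext fun g => congrFun h2 (ConjClasses.mk g)

/-! ### Specht classes generate the Grothendieck group -/

/-- The relation in the Grothendieck group given by a short exact sequence. -/
theorem repClass_of_exact {G : Type} [Group G] {X Y Z : FDRep ℂ G} (i : X →ₗ[ℂ] Y) (p : Y →ₗ[ℂ] Z)
    (hX : ∀ g : G, i ∘ₗ X.ρ g = Y.ρ g ∘ₗ i) (hZ : ∀ g : G, p ∘ₗ Y.ρ g = Z.ρ g ∘ₗ p)
    (hi : Function.Injective i) (he : Function.Exact i p) (hp : Function.Surjective p) :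
    repClass Y = repClass X + repClass Z := by
  have h : (QuotientAddGroup.mk (FreeAbelianGroup.of Y - FreeAbelianGroup.of X -
      FreeAbelianGroup.of Z) : RepGroup G) = 0 :=
    (QuotientAddGroup.eq_zero_iff _).2
      (AddSubgroup.subset_closure ⟨X, Y, Z, i, p, hX, hZ, hi, he, hp, rfl⟩)
  have h' : repClass Y - repClass X - repClass Z = 0 := h
  rw [sub_sub, sub_eq_zero] at h'
  exact h'

theorem repClass_eq_zero_of_subsingleton {G : Type} [Group G] (V : FDRep ℂ G) [Subsingleton V] :
    repClass V = 0 := by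
  -- For `V = 0` both maps may be the identity, giving `[V] = [V] + [V]`.
  have h := repClass_of_exact (X := V) (Y := V) (Z := V) LinearMap.id LinearMap.id
    (fun _ => rfl) (fun _ => rfl) Function.injective_id
    (fun y => ⟨fun _ => ⟨y, rfl⟩, fun _ => Subsingleton.elim _ _⟩) Function.surjective_id
  simpa using h

/-- A nonzero `V` has nonzero character at `1`, so it pairs nontrivially with some Specht module,
which then embeds in `V`; induct on dimension through the quotient. -/
theorem repClass_mem_closure_sigmaRep (V : FDRep ℂ (Equiv.Perm (Fin n))) :
    repClass V ∈ AddSubgroup.closure (Set.range fun l : n.Partition => repClass (sigmaRep l)) := by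
  induction hd : Module.finrank ℂ V using Nat.strong_induction_on generalizing V with
  | _ d ih =>
  rcases subsingleton_or_nontrivial V with hV | hV
  · rw [repClass_eq_zero_of_subsingleton]
    exact zero_mem _
  obtain ⟨l, hl⟩ : ∃ l : n.Partition,
      ∑ g, virtualCharacter _ (repClass V) g * virtualCharacter _ (repClass (sigmaRep l)) g ≠ 0 := by
    by_contra! hc
    have h0 := classFunction_eq_zero (fun g h => virtualCharacter_isConj (repClass V)) hc
    have h1 := congrFun h0 1
    rw [virtualCharacter_repClass, FDRep.char_one, Pi.zero_apply, Nat.cast_eq_zero] at h1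
    exact Module.finrank_pos.ne' h1
  have hfin : Module.finrank ℂ (Representation.IntertwiningMap (W := V) (spechtRep l) V.ρ) ≠ 0 := by
    intro h0
    have h1 := characterPairing_repClass V (sigmaRep l)
    rw [show Module.finrank ℂ (Representation.IntertwiningMap (V := sigmaRep l) (W := V)
      (sigmaRep l).ρ V.ρ) = 0 from h0, characterPairing] at h1
    simp only [virtualCharacter_perm_inv, Nat.cast_zero] at h1
    exact hl ((mul_eq_zero.1 h1).resolve_left
      (inv_ne_zero (Nat.cast_ne_zero.2 Fintype.card_ne_zero)))
  obtain ⟨f, hf⟩ : ∃ f : Representation.IntertwiningMap (W := V) (spechtRep l) V.ρ, f ≠ 0 := by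
    by_contra! hc
    have : Subsingleton (Representation.IntertwiningMap (W := V) (spechtRep l) V.ρ) :=
      ⟨fun a b => (hc a).trans (hc b).symm⟩
    exact hfin Module.finrank_zero_of_subsingleton
  have hinj := spechtRep_intertwiningMap_injective hf
  let R : Submodule ℂ V := LinearMap.range f.toLinearMap
  have hR : ∀ g, R ≤ R.comap (V.ρ g) := by
    rintro g _ ⟨x, rfl⟩
    exact ⟨spechtRep l g x, LinearMap.congr_fun (f.isIntertwining' g) x⟩
  let ρ' : Representation ℂ (Equiv.Perm (Fin n)) (V ⧸ R) := Representation.quotient V.ρ R hR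
  have hex : repClass V = repClass (sigmaRep l) + repClass (FDRep.of ρ') := by
    let i : (sigmaRep l : FDRep ℂ (Equiv.Perm (Fin n))) →ₗ[ℂ] V := f.toLinearMap
    exact repClass_of_exact (X := sigmaRep l) (Y := V) (Z := FDRep.of ρ') i R.mkQ
      f.isIntertwining' (fun g => LinearMap.ext fun x => rfl) hinj
      (LinearMap.exact_iff.2 (Submodule.ker_mkQ _)) (Submodule.mkQ_surjective _)
  rw [hex]
  refine add_mem (AddSubgroup.subset_closure ⟨l, rfl⟩) (ih _ ?_ (FDRep.of ρ') rfl)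
  have h1 : Module.finrank ℂ (V ⧸ R) + Module.finrank ℂ R = Module.finrank ℂ V :=
    Submodule.finrank_quotient_add_finrank R
  have h2 : 0 < Module.finrank ℂ R := by
    have hne : f (spechtGenerator l) ≠ 0 := fun h0 =>
      spechtGenerator_ne_zero l (hinj (h0.trans f.toLinearMap.map_zero.symm))
    have : Nontrivial R :=
      ⟨⟨_, spechtGenerator l, rfl⟩, 0, fun h => hne (congrArg Subtype.val h)⟩
    exact Module.finrank_pos
  change Module.finrank ℂ (V ⧸ R) < d
  omega

theorem closure_range_sigmaRep :
    AddSubgroup.closure (Set.range fun l : n.Partition => repClass (sigmaRep l)) = ⊤ := by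
  rw [eq_top_iff]
  rintro x -
  obtain ⟨x, rfl⟩ := QuotientAddGroup.mk_surjective x
  induction x using FreeAbelianGroup.induction_on with
  | zero => exact zero_mem _
  | of V => exact repClass_mem_closure_sigmaRep V
  | neg x hx => exact neg_mem hx
  | add x y hx hy => exact add_mem hx hy

theorem repGroup_perm_hom_ext {N : Type*} [AddCommGroup N]
    {f g : RepGroup (Equiv.Perm (Fin n)) →+ N}
    (h : ∀ l : n.Partition, f (repClass (sigmaRep l)) = g (repClass (sigmaRep l))) : f = g :=
  AddMonoidHom.eq_of_eqOn_dense closure_range_sigmaRep (by rintro _ ⟨l, rfl⟩; exact h l)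

end SymmetricCharacters

/-! ### Integrality of the elliptic pairing -/

section Integrality

/-- Expand by row multilinearity: each row comes from `-A` or from the identity, and identity rows
reduce the determinant to a principal minor. -/
theorem det_one_sub_eq_sum_minors {ι R : Type*} [Fintype ι] [DecidableEq ι] [CommRing R]
    (A : Matrix ι ι R) :
    (1 - A).det = ∑ s : Finset ι, (-1) ^ s.card *
      (A.submatrix (Subtype.val : s → ι) (Subtype.val : s → ι)).det := by
  rw [sub_eq_neg_add]
  have h2 := (Matrix.detRowAlternating (n := ι) (R := R)).toMultilinearMap.map_add_univ
    (fun i => (-A) i) fun i => (1 : Matrix ι ι R) i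
  refine h2.trans (Finset.sum_congr rfl fun s _ => ?_)
  refine (Matrix.det_piecewise_one_eq_submatrix_det (-A) s).trans ?_
  rw [show (-A).submatrix (Subtype.val : s → ι) (Subtype.val : s → ι) =
    -(A.submatrix (Subtype.val : s → ι) (Subtype.val : s → ι)) from rfl, Matrix.det_neg,
    Fintype.card_coe]

theorem trace_exteriorPower_map {n : ℕ} {R : Type*} [CommRing R] (k : ℕ)
    (A : Matrix (Fin n) (Fin n) R) :
    LinearMap.trace R _ (exteriorPower.map k (Matrix.toLin' A)) =
      ∑ s ∈ Finset.univ.powersetCard k,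
        (A.submatrix (Subtype.val : s → Fin n) (Subtype.val : s → Fin n)).det := by
  classical
  let b := (Pi.basisFun R (Fin n)).exteriorPower k
  rw [LinearMap.trace_eq_matrix_trace R b, Matrix.trace]
  have h : ∀ s : Set.powersetCard (Fin n) k,
      (LinearMap.toMatrix b b (exteriorPower.map k (Matrix.toLin' A))).diag s =
        (A.submatrix (Subtype.val : {i // i ∈ s.1} → Fin n)
          (Subtype.val : {i // i ∈ s.1} → Fin n)).det := by
    intro s
    rw [Matrix.diag_apply, LinearMap.toMatrix_apply, exteriorPower.basis_repr_apply,
      exteriorPower.basis_apply, exteriorPower.map_apply_ιMulti_family,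
      exteriorPower.ιMulti_family, exteriorPower.ιMultiDual_apply_ιMulti]
    rw [← Matrix.det_submatrix_equiv_self
      ((s : Finset (Fin n)).orderIsoOfFin s.2).toEquiv, ← Matrix.det_transpose]
    congr 1
    ext i j
    simp [Set.powersetCard.ofFinEmbEquiv]
    rfl
  rw [Finset.sum_congr rfl fun s _ => h s]
  refine Finset.sum_bij (fun s _ => (s : Finset (Fin n))) ?_ ?_ ?_ ?_
  · intro s _
    exact Finset.mem_powersetCard.2 ⟨Finset.subset_univ _, s.2⟩
  · intro s _ t _ h
    exact Subtype.ext h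
  · intro s hs
    exact ⟨⟨s, (Finset.mem_powersetCard.1 hs).2⟩, Finset.mem_univ _, rfl⟩
  · intro s _
    rfl

/-- `det(1 - A)` is the alternating sum of the traces of `A` on the exterior powers. -/
theorem det_one_sub_eq_sum_trace_exteriorPower {n : ℕ} {R : Type*} [CommRing R]
    (A : Matrix (Fin n) (Fin n) R) :
    (1 - A).det = ∑ k ∈ Finset.range (n + 1), (-1) ^ k *
      LinearMap.trace R _ (exteriorPower.map k (Matrix.toLin' A)) := by
  rw [det_one_sub_eq_sum_minors, ← Finset.powerset_univ, Finset.sum_powerset, Finset.card_univ,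
    Fintype.card_fin]
  refine Finset.sum_congr rfl fun k _ => ?_
  rw [trace_exteriorPower_map, Finset.mul_sum]
  exact Finset.sum_congr rfl fun s hs => by rw [(Finset.mem_powersetCard.1 hs).2]

/-- The exterior powers of a representation. -/
noncomputable def exteriorPowerRep {R G V : Type*} [CommRing R] [Monoid G] [AddCommGroup V]
    [Module R V] (ρ : Representation R G V) (k : ℕ) : Representation R G (⋀[R]^k V) where
  toFun g := exteriorPower.map k (ρ g)
  map_one' := by rw [map_one]; exact exteriorPower.map_id
  map_mul' g h := by
    rw [map_mul, Module.End.mul_eq_comp, Module.End.mul_eq_comp, exteriorPower.map_comp]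

/-- The complexification of a real representation on `ℝ^n`. -/
noncomputable def complexifyRep {G : Type*} [Monoid G] {n : ℕ} (ρ : Representation ℝ G (Fin n → ℝ)) :
    Representation ℂ G (Fin n → ℂ) where
  toFun g := Matrix.toLin' ((LinearMap.toMatrix' (ρ g)).map Complex.ofRealHom)
  map_one' := by
    rw [map_one, LinearMap.toMatrix'_one, Matrix.map_one _ (map_zero _) (map_one _),
      Matrix.toLin'_one]
    rfl
  map_mul' g h := by
    rw [map_mul, LinearMap.toMatrix'_mul, Matrix.map_mul, Matrix.toLin'_mul]
    rfl

theorem det_one_sub_eq_sum_character {G : Type*} [Monoid G] {n : ℕ}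
    (ρ : Representation ℝ G (Fin n → ℝ)) (g : G) :
    ((LinearMap.det (1 - ρ g) : ℝ) : ℂ) = ∑ k ∈ Finset.range (n + 1), (-1) ^ k *
      (exteriorPowerRep (complexifyRep ρ) k).character g := by
  refine Eq.trans ?_ (det_one_sub_eq_sum_trace_exteriorPower
    ((LinearMap.toMatrix' (ρ g)).map Complex.ofRealHom))
  rw [← LinearMap.det_toMatrix', map_sub, LinearMap.toMatrix'_one]
  change Complex.ofRealHom _ = _
  rw [RingHom.map_det]
  congr 1
  ext i j
  by_cases h : i = j <;> simp [h]

/-- The pairing is the alternating sum over `k` of the dimensions of the invariants in $V\otimes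
U\otimes\Lambda^kE_{\mathbb C}$. -/
theorem ellipticPairing_repClass_integral {W : Type} [Group W] [Fintype W] {n : ℕ}
    (ρ : Representation ℝ W (Fin n → ℝ)) (V U : FDRep ℂ W) :
    ∃ z : ℤ, ellipticPairing ρ (repClass V) (repClass U) = z := by
  have : Invertible (Nat.card W : ℂ) := invertibleOfNonzero (Nat.cast_ne_zero.2 Nat.card_pos.ne')
  let τ : Representation ℂ W (TensorProduct ℂ V U) :=
    Representation.tprod (V := V) (W := U) V.ρ U.ρ
  let d : ℕ → ℕ := fun k => Module.finrank ℂ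
    (τ.tprod (exteriorPowerRep (complexifyRep ρ) k)).invariants
  refine ⟨∑ k ∈ Finset.range (n + 1), (-1) ^ k * d k, ?_⟩
  have hd : ∀ k, (d k : ℂ) = (Fintype.card W : ℂ)⁻¹ * ∑ w : W,
      V.character w * U.character w * (exteriorPowerRep (complexifyRep ρ) k).character w := by
    intro k
    rw [← Representation.card_inv_mul_sum_char_eq_finrank, Representation.char_tensor,
      Nat.card_eq_fintype_card]
    congr 1
    refine Finset.sum_congr rfl fun w _ => ?_
    rw [Pi.mul_apply]
    congr 1
    exact congrFun (Representation.char_tensor (V := V) (W := U) V.ρ U.ρ) w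
  push_cast
  simp_rw [hd, ellipticPairing, virtualCharacter_repClass, det_one_sub_eq_sum_character,
    Finset.mul_sum]
  rw [Finset.sum_comm]
  refine Finset.sum_congr rfl fun k _ => Finset.sum_congr rfl fun w _ => ?_
  ring

theorem ellipticPairing_integral {W : Type} [Group W] [Fintype W] {n : ℕ}
    (ρ : Representation ℝ W (Fin n → ℝ)) (x : RepGroup W) (U : FDRep ℂ W) :
    ∃ z : ℤ, ellipticPairing ρ x (repClass U) = z := by
  obtain ⟨x, rfl⟩ := QuotientAddGroup.mk_surjective x
  induction x using FreeAbelianGroup.induction_on with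
  | zero => exact ⟨0, by simp [ellipticPairing]⟩
  | of V => exact ellipticPairing_repClass_integral ρ V U
  | neg x hx =>
    obtain ⟨z, hz⟩ := hx
    exact ⟨-z, by rw [QuotientAddGroup.mk_neg, ellipticPairing_neg_left, hz, Int.cast_neg]⟩
  | add x y hx hy =>
    obtain ⟨z, hz⟩ := hx
    obtain ⟨z', hz'⟩ := hy
    exact ⟨z + z', by
      rw [QuotientAddGroup.mk_add, ellipticPairing_add_left, hz, hz', Int.cast_add]⟩

end Integrality

/-! ### Elliptic elements of the Weyl group of type `B_n` -/

section EllipticElements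

variable {n : ℕ}

theorem WeylB.reflectionRep_apply (w : WeylB n) (v : Fin n → ℝ) (i : Fin n) :
    WeylB.reflectionRep n w v i = ((w.left i : ℤ) : ℝ) * v (w.right⁻¹ i) := rfl

theorem WeylB.card (n : ℕ) :
    Fintype.card (WeylB n) = 2 ^ n * Fintype.card (Equiv.Perm (Fin n)) := by
  rw [Fintype.card_congr SemidirectProduct.equivProd, Fintype.card_prod]
  simp

theorem WeylB.sum_eq {M : Type*} [AddCommMonoid M] (f : WeylB n → M) :
    ∑ w, f w = ∑ g : Equiv.Perm (Fin n), ∑ ε : Fin n → ℤˣ, f ⟨ε, g⟩ := by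
  rw [← SemidirectProduct.equivProd.symm.sum_comp, Fintype.sum_prod_type_right]
  rfl

/-- The sum of `det(1 - w)` over all `w` with a given image in `S_n`. -/
theorem WeylB.sum_det_one_sub (g : Equiv.Perm (Fin n)) :
    ∑ ε : Fin n → ℤˣ, LinearMap.det (1 - WeylB.reflectionRep n ⟨ε, g⟩) = 2 ^ n := by
  -- Row `i` of `1 - w` involves only the sign at `i`, so the sum over all signs can be taken row by
  -- row; in each row the two choices add up to twice the basis vector.
  let F : Fin n → ℤˣ → Fin n → ℝ := fun i u => Pi.single i 1 - ((u : ℤ) : ℝ) • Pi.single (g⁻¹ i) 1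
  have h1 : ∀ ε : Fin n → ℤˣ, LinearMap.det (1 - WeylB.reflectionRep n ⟨ε, g⟩) =
      Matrix.detRowAlternating (R := ℝ) fun i => F i (ε i) := by
    intro ε
    rw [← LinearMap.det_toMatrix']
    refine congrArg Matrix.det (Matrix.ext fun i j => ?_)
    rw [LinearMap.toMatrix'_apply, LinearMap.sub_apply, Pi.sub_apply,
      WeylB.reflectionRep_apply]
    simp [F, Pi.single_apply, eq_comm]
  simp_rw [h1]
  have h2 := (Matrix.detRowAlternating (n := Fin n) (R := ℝ)).toMultilinearMap.map_sum F
  refine h2.symm.trans ?_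
  have h3 : (fun i => ∑ u, F i u) = ((2 : ℝ) • (1 : Matrix (Fin n) (Fin n) ℝ)).row := by
    ext i j
    simp [F, Matrix.one_apply, Pi.single_apply, eq_comm]
  rw [h3]
  change Matrix.det ((2 : ℝ) • (1 : Matrix (Fin n) (Fin n) ℝ)) = _
  rw [Matrix.det_smul, Matrix.det_one, mul_one, Fintype.card_fin]

/-! ### Cycle signs and conjugacy -/

/-- The sign picked up by the basis vector `e_r` under the `k`-th power of the signed permutation
`(ε, g)`. -/
def orbitSign (ε : Fin n → ℤˣ) (g : Equiv.Perm (Fin n)) (k : ℕ) (r : Fin n) : ℤˣ :=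
  ∏ i ∈ Finset.range k, ε (g^[i + 1] r)

theorem orbitSign_add (ε : Fin n → ℤˣ) (g : Equiv.Perm (Fin n)) (j k : ℕ) (r : Fin n) :
    orbitSign ε g (j + k) r = orbitSign ε g j r * orbitSign ε g k (g^[j] r) := by
  rw [orbitSign, Finset.prod_range_add, orbitSign, orbitSign]
  congr 1
  refine Finset.prod_congr rfl fun i _ => ?_
  rw [← Function.iterate_add_apply]
  congr 2
  ring

theorem orbitSign_succ (ε : Fin n → ℤˣ) (g : Equiv.Perm (Fin n)) (k : ℕ) (r : Fin n) :
    orbitSign ε g (k + 1) r = orbitSign ε g k r * ε (g^[k + 1] r) :=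
  Finset.prod_range_succ _ _

theorem orbitSign_mul (ε ε' : Fin n → ℤˣ) (g : Equiv.Perm (Fin n)) (k : ℕ) (r : Fin n) :
    orbitSign (ε * ε') g k r = orbitSign ε g k r * orbitSign ε' g k r :=
  Finset.prod_mul_distrib

theorem orbitSign_minimalPeriod_mul (ε : Fin n → ℤˣ) (g : Equiv.Perm (Fin n)) (t : ℕ) (r : Fin n) :
    orbitSign ε g (Function.minimalPeriod g r * t) r =
      orbitSign ε g (Function.minimalPeriod g r) r ^ t := by
  induction t with
  | zero => simp [orbitSign]
  | succ t ih =>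
    rw [Nat.mul_succ, orbitSign_add, ih, pow_succ]
    congr 2
    exact ((Function.isPeriodicPt_minimalPeriod g r).mul_const t).eq

/-- If the signs multiply to `1` around each cycle of `g`, then they form a coboundary. -/
theorem exists_coboundary_of_orbitSign_eq_one {η : Fin n → ℤˣ} {g : Equiv.Perm (Fin n)}
    (h : ∀ k r, g^[k] r = r → orbitSign η g k r = 1) :
    ∃ δ : Fin n → ℤˣ, ∀ j, δ (g j) = η (g j) * δ j := by
  have hwd : ∀ r k l, g^[k] r = g^[l] r → k ≤ l → orbitSign η g k r = orbitSign η g l r := by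
    intro r k l hkl hle
    obtain ⟨d, rfl⟩ := Nat.exists_eq_add_of_le hle
    rw [orbitSign_add, h d (g^[k] r), mul_one]
    rw [← Function.iterate_add_apply, add_comm, ← hkl]
  have hwd' : ∀ r k l, g^[k] r = g^[l] r → orbitSign η g k r = orbitSign η g l r := by
    intro r k l hkl
    rcases le_total k l with hle | hle
    · exact hwd r k l hkl hle
    · exact (hwd r l k hkl.symm hle).symm
  let s : Setoid (Fin n) := Equiv.Perm.SameCycle.setoid g
  let rep : Fin n → Fin n := fun j => (Quotient.mk s j).out
  have hrep : ∀ j, ∃ k : ℕ, g^[k] (rep j) = j := by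
    intro j
    have hs : g.SameCycle (rep j) j := Quotient.mk_out (s := s) j
    obtain ⟨k, hk⟩ := hs.exists_nat_pow_eq
    exact ⟨k, by rw [← Equiv.Perm.coe_pow, hk]⟩
  have hg : ∀ j, rep (g j) = rep j := fun j => by
    have : Quotient.mk s (g j) = Quotient.mk s j :=
      Quotient.sound (Equiv.Perm.sameCycle_apply_left.2 (Equiv.Perm.SameCycle.refl g j))
    simp only [rep, this]
  choose k hk using hrep
  -- Accumulate the signs from a chosen representative of the cycle; trivial cycle products make
  -- this independent of the path.
  refine ⟨fun j => orbitSign η g (k j) (rep j), fun j => ?_⟩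
  have h1 : g^[k j + 1] (rep j) = g j := by rw [Function.iterate_succ_apply', hk]
  have h2 := hwd' (rep j) (k (g j)) (k j + 1) (by rw [h1, ← hg j, hk])
  dsimp only
  rw [hg, h2, orbitSign_succ, h1, mul_comm]

/-- All cycles of an elliptic signed permutation are negative. -/
theorem orbitSign_minimalPeriod_of_det_ne_zero {w : WeylB n}
    (hw : LinearMap.det (1 - WeylB.reflectionRep n w) ≠ 0) (r : Fin n) :
    orbitSign w.left w.right (Function.minimalPeriod w.right r) r = -1 := by
  by_contra hne
  have h1 := (Int.units_eq_one_or _).resolve_right hne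
  set g := w.right with hg
  set m := Function.minimalPeriod g r with hm
  have hgm : g^[m] r = r := Function.isPeriodicPt_minimalPeriod g r
  have hmpos : 0 < m := Function.minimalPeriod_pos_of_mem_periodicPts
    (g.injective.mem_periodicPts r)
  let f : Fin n → ℕ → ℝ := fun j k =>
    if g^[k] r = j then ((orbitSign w.left g k r : ℤ) : ℝ) else 0
  -- Summing the images of `e_r` once around a positive cycle gives a nonzero vector fixed by `w`,
  -- contradicting invertibility of `1 - w`.
  let v : Fin n → ℝ := fun j => ∑ k ∈ Finset.range m, f j k
  have hfix : WeylB.reflectionRep n w v = v := by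
    ext j
    rw [WeylB.reflectionRep_apply, ← hg]
    have hs : ∀ k, ((w.left j : ℤ) : ℝ) * f (g⁻¹ j) k = f j (k + 1) := by
      intro k
      have hiff : g^[k] r = g⁻¹ j ↔ g^[k + 1] r = j := by
        rw [Function.iterate_succ_apply', Equiv.Perm.eq_inv_iff_eq]
      simp only [f, hiff]
      split_ifs with hj
      · rw [orbitSign_succ, hj]
        push_cast
        ring
      · rw [mul_zero]
    simp only [v, Finset.mul_sum, hs]
    have h2 := Finset.sum_range_succ (f j) m
    rw [Finset.sum_range_succ'] at h2
    have h3 : f j m = f j 0 := by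
      simp only [f, hgm, h1]
      simp [orbitSign]
    rw [h3] at h2
    exact add_right_cancel h2
  have hvr : v r = 1 := by
    simp only [v]
    rw [Finset.sum_eq_single_of_mem 0 (Finset.mem_range.2 hmpos)]
    · simp [f, orbitSign]
    · intro k hk hk0
      refine if_neg fun hp => ?_
      exact (Function.not_isPeriodicPt_of_pos_of_lt_minimalPeriod hk0 (Finset.mem_range.1 hk)) hp
  have hinj : Function.Injective (1 - WeylB.reflectionRep n w : (Fin n → ℝ) →ₗ[ℝ] Fin n → ℝ) :=
    (LinearMap.equivOfDetNeZero _ hw).injective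
  have hv0 : v = 0 := hinj (by
    rw [map_zero, LinearMap.sub_apply, hfix]
    exact sub_self v)
  rw [hv0] at hvr
  exact zero_ne_one hvr

/-- Elliptic signed permutations with the same underlying permutation are conjugate. -/
theorem WeylB.isConj_of_det_ne_zero {w w' : WeylB n} (h : w.right = w'.right)
    (hw : LinearMap.det (1 - WeylB.reflectionRep n w) ≠ 0)
    (hw' : LinearMap.det (1 - WeylB.reflectionRep n w') ≠ 0) : IsConj w w' := by
  obtain ⟨ε, g⟩ := w
  obtain ⟨ε', g'⟩ := w'
  obtain rfl : g = g' := h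
  -- Both sign patterns have product `-1` around every cycle, so their product is a coboundary; `δ`
  -- then conjugates one element to the other.
  obtain ⟨δ, hδ⟩ := exists_coboundary_of_orbitSign_eq_one (η := ε * ε') (g := g) (by
    intro k r hk
    obtain ⟨t, rfl⟩ := (show Function.IsPeriodicPt g k r from hk).minimalPeriod_dvd
    rw [orbitSign_mul, orbitSign_minimalPeriod_mul, orbitSign_minimalPeriod_mul,
      show orbitSign ε g _ r = -1 from orbitSign_minimalPeriod_of_det_ne_zero hw r,
      show orbitSign ε' g _ r = -1 from orbitSign_minimalPeriod_of_det_ne_zero hw' r,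
      ← mul_pow, neg_mul_neg, one_mul, one_pow])
  refine isConj_iff.2 ⟨SemidirectProduct.inl δ, mul_inv_eq_iff_eq_mul.2 ?_⟩
  refine SemidirectProduct.ext (funext fun i => ?_) ?_
  · change δ i * ε i = ε' i * δ (g⁻¹ i)
    have := hδ (g⁻¹ i)
    rw [show g (g⁻¹ i) = i by simp] at this
    rw [this, Pi.mul_apply]
    have h2 := Int.units_mul_self (ε i)
    calc ε i * ε' i * δ (g⁻¹ i) * ε i = (ε i * ε i) * (ε' i * δ (g⁻¹ i)) := by
          simp only [mul_comm, mul_left_comm, mul_assoc]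
      _ = _ := by rw [h2, one_mul]
  · simp

end EllipticElements

/-! ### The main theorem -/

section Main

variable {n : ℕ}

/-- A finite generating family with a dual family is a basis. -/
theorem exists_basis_of_dual {M ι : Type*} [AddCommGroup M] [Fintype ι] [DecidableEq ι]
    {v : ι → M} (φ : ι → M →+ ℂ) (hφ : ∀ i j, φ j (v i) = if i = j then 1 else 0)
    (hv : AddSubgroup.closure (Set.range v) = ⊤) :
    ∃ b : Module.Basis ι ℤ M, ∀ i, b i = v i := by
  have hli : LinearIndependent ℤ v := by
    rw [Fintype.linearIndependent_iff]
    intro c hc j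
    have h := congrArg (φ j) hc
    simpa [hφ] using h
  have hsp : ⊤ ≤ Submodule.span ℤ (Set.range v) := by
    rintro x -
    have hx : x ∈ AddSubgroup.closure (Set.range v) := hv ▸ AddSubgroup.mem_top x
    rwa [← Submodule.span_int_eq_addSubgroupClosure] at hx
  exact ⟨.mk hli hsp, fun i => Module.Basis.mk_apply hli hsp i⟩

/-- The character pairing with a fixed element. -/
noncomputable def characterPairingHom {G : Type} [Group G] [Fintype G] (y : RepGroup G) :
    RepGroup G →+ ℂ where
  toFun x := characterPairing x y
  map_zero' := by simp [characterPairing]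
  map_add' x x' := by
    simp only [characterPairing, map_add, Pi.add_apply, add_mul, Finset.sum_add_distrib, mul_add]

/-- The induced elliptic pairing with a fixed element. -/
noncomputable def ellipticPairingBarHom {W : Type} [Group W] [Fintype W] {E : Type} [AddCommGroup E]
    [Module ℝ E] (ρ : Representation ℝ W E) (y : EllipticRepGroup ρ) :
    EllipticRepGroup ρ →+ ℂ where
  toFun x := ellipticPairingBar ρ x y
  map_zero' := by
    obtain ⟨y, rfl⟩ := QuotientAddGroup.mk_surjective y
    rw [← QuotientAddGroup.mk_zero, ellipticPairingBar_mk]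
    simp [ellipticPairing]
  map_add' x x' := by
    obtain ⟨y, rfl⟩ := QuotientAddGroup.mk_surjective y
    obtain ⟨x, rfl⟩ := QuotientAddGroup.mk_surjective x
    obtain ⟨x', rfl⟩ := QuotientAddGroup.mk_surjective x'
    rw [← QuotientAddGroup.mk_add]
    simp only [ellipticPairingBar_mk, ellipticPairing_add_left]

theorem ellipticPairingBar_comm {W : Type} [Group W] [Fintype W] {E : Type} [AddCommGroup E]
    [Module ℝ E] (ρ : Representation ℝ W E) (x y : EllipticRepGroup ρ) :
    ellipticPairingBar ρ x y = ellipticPairingBar ρ y x := by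
  obtain ⟨y, rfl⟩ := QuotientAddGroup.mk_surjective y
  obtain ⟨x, rfl⟩ := QuotientAddGroup.mk_surjective x
  rw [ellipticPairingBar_mk, ellipticPairingBar_mk, ellipticPairing_comm]

theorem virtualCharacter_lambdaTimesEmpty (l : n.Partition) (w : WeylB n) :
    virtualCharacter _ (repClass (lambdaTimesEmpty l)) w =
      virtualCharacter _ (repClass (sigmaRep l)) w.right := by
  rw [virtualCharacter_repClass, virtualCharacter_repClass]
  rfl

theorem ellipticPairing_lambdaTimesEmpty (l m : n.Partition) :
    ellipticPairing (WeylB.reflectionRep n) (repClass (lambdaTimesEmpty l))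
      (repClass (lambdaTimesEmpty m)) = if l = m then 1 else 0 := by
  rw [← characterPairing_sigmaRep, ellipticPairing, characterPairing, WeylB.sum_eq, WeylB.card]
  simp only [virtualCharacter_lambdaTimesEmpty, virtualCharacter_perm_inv, ← Finset.mul_sum,
    ← Complex.ofReal_sum, WeylB.sum_det_one_sub]
  rw [← Finset.sum_mul]
  push_cast
  rw [mul_inv]
  field_simp

theorem WeylB.det_one_sub_conj (w u : WeylB n) :
    LinearMap.det (1 - WeylB.reflectionRep n (u * w * u⁻¹)) =
      LinearMap.det (1 - WeylB.reflectionRep n w) := by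
  have h : 1 - WeylB.reflectionRep n (u * w * u⁻¹) =
      WeylB.reflectionRep n u * (1 - WeylB.reflectionRep n w) * WeylB.reflectionRep n u⁻¹ := by
    rw [mul_sub, sub_mul, mul_one, ← map_mul, ← map_mul, ← map_mul, mul_inv_cancel, map_one]
  have hu : LinearMap.det (WeylB.reflectionRep n u) * LinearMap.det (WeylB.reflectionRep n u⁻¹) =
      1 := by
    rw [← map_mul, ← map_mul, mul_inv_cancel, map_one, map_one]
  rw [h, map_mul, map_mul, mul_right_comm, hu, one_mul]

/-- The function on `S_n` obtained by averaging a virtual character of `W(B_n)`, weighted by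
`det(1 - w)`, over the fibres of `W(B_n) → S_n`. -/
noncomputable def ellipticFibreSum (x : RepGroup (WeylB n)) (g : Equiv.Perm (Fin n)) : ℂ :=
  ∑ ε : Fin n → ℤˣ, virtualCharacter _ x ⟨ε, g⟩ *
    ((LinearMap.det (1 - WeylB.reflectionRep n ⟨ε, g⟩) : ℝ) : ℂ)

theorem ellipticFibreSum_conj (x : RepGroup (WeylB n)) (g h : Equiv.Perm (Fin n)) :
    ellipticFibreSum x (h * g * h⁻¹) = ellipticFibreSum x g := by
  refine Eq.symm (Fintype.sum_equiv
    (mulAutArrow (G := Equiv.Perm (Fin n)) (A := Fin n) (M := ℤˣ) h).toEquiv _ _ fun ε => ?_)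
  have hc : (SemidirectProduct.inr h * ⟨ε, g⟩ * (SemidirectProduct.inr h)⁻¹ : WeylB n) =
      ⟨mulAutArrow (G := Equiv.Perm (Fin n)) (A := Fin n) (M := ℤˣ) h ε, h * g * h⁻¹⟩ := by
    rw [mul_inv_eq_iff_eq_mul]
    refine SemidirectProduct.ext ?_ ?_ <;> simp
  have h1 := virtualCharacter_conj x (⟨ε, g⟩ : WeylB n) (SemidirectProduct.inr h)
  have h2 := WeylB.det_one_sub_conj (⟨ε, g⟩ : WeylB n) (SemidirectProduct.inr h)
  rw [hc] at h1 h2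
  rw [← h1, ← h2]
  rfl

theorem ellipticPairing_lambdaTimesEmpty_right (x : RepGroup (WeylB n)) (l : n.Partition) :
    ellipticPairing (WeylB.reflectionRep n) x (repClass (lambdaTimesEmpty l)) =
      (Fintype.card (WeylB n) : ℂ)⁻¹ *
        ∑ g, ellipticFibreSum x g * virtualCharacter _ (repClass (sigmaRep l)) g := by
  rw [ellipticPairing, WeylB.sum_eq]
  congr 1
  refine Finset.sum_congr rfl fun g _ => ?_
  rw [ellipticFibreSum, Finset.sum_mul]
  refine Finset.sum_congr rfl fun ε _ => ?_
  rw [virtualCharacter_lambdaTimesEmpty]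
  ring

/-- An element of `R(W(B_n))` orthogonal to all `λ × ∅` lies in the radical. -/
theorem mem_ellipticRadical_of_orthogonal {x : RepGroup (WeylB n)}
    (hx : ∀ l : n.Partition,
      ellipticPairing (WeylB.reflectionRep n) x (repClass (lambdaTimesEmpty l)) = 0) :
    x ∈ ellipticRadical (WeylB.reflectionRep n) := by
  have hF : ellipticFibreSum x = 0 := by
    refine classFunction_eq_zero (fun g h hgh => ?_) fun l => ?_
    · obtain ⟨c, rfl⟩ := isConj_iff.1 hgh
      rw [ellipticFibreSum_conj]
    · have h := hx l
      rw [ellipticPairing_lambdaTimesEmpty_right] at h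
      exact (mul_eq_zero.1 h).resolve_left
        (inv_ne_zero (Nat.cast_ne_zero.2 Fintype.card_ne_zero))
  have key : ∀ w : WeylB n, LinearMap.det (1 - WeylB.reflectionRep n w) ≠ 0 →
      virtualCharacter _ x w = 0 := by
    intro w hw
    have h1 := congrFun hF w.right
    -- Only elliptic elements contribute to the fibre sum, and they are all conjugate to `w`, so the
    -- value of `x` factors out.
    have h2 : ellipticFibreSum x w.right = virtualCharacter _ x w * 2 ^ n := by
      have h3 := congrArg (fun r : ℝ => virtualCharacter _ x w * (r : ℂ))
        (WeylB.sum_det_one_sub w.right)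
      rw [Complex.ofReal_sum, Finset.mul_sum, Complex.ofReal_pow, Complex.ofReal_ofNat] at h3
      rw [← h3, ellipticFibreSum]
      refine Finset.sum_congr rfl fun ε _ => ?_
      by_cases h0 : LinearMap.det (1 - WeylB.reflectionRep n ⟨ε, w.right⟩) = 0
      · rw [h0, Complex.ofReal_zero, mul_zero, mul_zero]
      · rw [virtualCharacter_isConj x (WeylB.isConj_of_det_ne_zero (w := ⟨ε, w.right⟩) (w' := w) rfl
          h0 hw)]
    rw [h2, Pi.zero_apply] at h1
    exact (mul_eq_zero.1 h1).resolve_right (pow_ne_zero _ two_ne_zero)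
  intro y
  rw [ellipticPairing, Finset.sum_eq_zero, mul_zero]
  intro w _
  by_cases h0 : LinearMap.det (1 - WeylB.reflectionRep n w) = 0
  · rw [h0, Complex.ofReal_zero, mul_zero]
  · rw [key w h0, zero_mul, zero_mul]

/-- Pairing with the orthonormal classes gives integer coefficients; the corresponding combination
differs from `x` by an element orthogonal to all of them, hence in the radical. -/
theorem closure_range_ellipticClass :
    AddSubgroup.closure (Set.range fun l : n.Partition =>
      ellipticClass (WeylB.reflectionRep n) (lambdaTimesEmpty l)) = ⊤ := by
  rw [eq_top_iff]
  rintro x -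
  obtain ⟨x, rfl⟩ := QuotientAddGroup.mk_surjective x
  choose z hz using fun l : n.Partition =>
    ellipticPairing_integral (WeylB.reflectionRep n) x (lambdaTimesEmpty l)
  set y : RepGroup (WeylB n) := ∑ l, z l • repClass (lambdaTimesEmpty l) with hy
  have hrad : -y + x ∈ ellipticRadical (WeylB.reflectionRep n) := by
    refine mem_ellipticRadical_of_orthogonal fun m => ?_
    have h := map_sum (ellipticPairingBarHom (WeylB.reflectionRep n)
      (ellipticClass _ (lambdaTimesEmpty m)))
      (fun l => z l • ellipticClass (WeylB.reflectionRep n) (lambdaTimesEmpty l)) Finset.univ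
    have hyb : (QuotientAddGroup.mk y : EllipticRepGroup (WeylB.reflectionRep n)) =
        ∑ l, z l • ellipticClass (WeylB.reflectionRep n) (lambdaTimesEmpty l) := by
      rw [hy]
      exact map_sum (QuotientAddGroup.mk' (ellipticRadical (WeylB.reflectionRep n))) _ _
    rw [← hyb] at h
    have hval : ∀ l, ellipticPairingBarHom (WeylB.reflectionRep n)
        (ellipticClass _ (lambdaTimesEmpty m))
        (ellipticClass (WeylB.reflectionRep n) (lambdaTimesEmpty l)) = if l = m then 1 else 0 :=
      fun l => ellipticPairing_lambdaTimesEmpty l m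
    simp only [map_zsmul, hval] at h
    rw [ellipticPairing_add_left, ellipticPairing_neg_left, hz m]
    have h' : ellipticPairing (WeylB.reflectionRep n) y (repClass (lambdaTimesEmpty m)) = z m := by
      refine Eq.trans h ?_
      simp
    rw [h', neg_add_cancel]
  have hxy : (QuotientAddGroup.mk x : EllipticRepGroup (WeylB.reflectionRep n)) =
      ∑ l, z l • ellipticClass (WeylB.reflectionRep n) (lambdaTimesEmpty l) := by
    rw [← QuotientAddGroup.eq.2 hrad, hy]
    exact map_sum (QuotientAddGroup.mk' (ellipticRadical (WeylB.reflectionRep n))) _ _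
  rw [hxy]
  exact sum_mem fun l _ => zsmul_mem (AddSubgroup.subset_closure (Set.mem_range_self l)) _

end Main

theorem lemmal (n : ℕ) :
    (∃ b : Module.Basis n.Partition ℤ (EllipticRepGroup (WeylB.reflectionRep n)),
      (∀ l : n.Partition, b l = ellipticClass (WeylB.reflectionRep n) (lambdaTimesEmpty l)) ∧
      ∀ l m : n.Partition,
        ellipticPairingBar (WeylB.reflectionRep n) (b l) (b m) = if l = m then 1 else 0) ∧
    ∃ φ : RepGroup (Equiv.Perm (Fin n)) ≃+ EllipticRepGroup (WeylB.reflectionRep n),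
      (∀ l : n.Partition,
        φ (repClass (sigmaRep l)) =
          ellipticClass (WeylB.reflectionRep n) (lambdaTimesEmpty l)) ∧
      (∀ x y : RepGroup (Equiv.Perm (Fin n)),
        ellipticPairingBar (WeylB.reflectionRep n) (φ x) (φ y) = characterPairing x y) ∧
      ∀ ψ : RepGroup (Equiv.Perm (Fin n)) →+ EllipticRepGroup (WeylB.reflectionRep n),
        (∀ l : n.Partition,
          ψ (repClass (sigmaRep l)) =
            ellipticClass (WeylB.reflectionRep n) (lambdaTimesEmpty l)) →
        ψ = φ := by
  have hbar : ∀ l m : n.Partition, ellipticPairingBar (WeylB.reflectionRep n)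
      (ellipticClass _ (lambdaTimesEmpty l)) (ellipticClass _ (lambdaTimesEmpty m)) =
        if l = m then 1 else 0 := ellipticPairing_lambdaTimesEmpty
  obtain ⟨b, hb⟩ := exists_basis_of_dual
    (fun m => ellipticPairingBarHom (WeylB.reflectionRep n) (ellipticClass _ (lambdaTimesEmpty m)))
    hbar closure_range_ellipticClass
  obtain ⟨a, ha⟩ := exists_basis_of_dual
    (fun m => characterPairingHom (repClass (sigmaRep m))) characterPairing_sigmaRep
    (closure_range_sigmaRep (n := n))
  refine ⟨⟨b, hb, fun l m => by rw [hb, hb, hbar]⟩, (a.equiv b (Equiv.refl _)).toAddEquiv, ?_⟩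
  have hφ : ∀ l : n.Partition, (a.equiv b (Equiv.refl _)).toAddEquiv (repClass (sigmaRep l)) =
      ellipticClass (WeylB.reflectionRep n) (lambdaTimesEmpty l) := fun l => by
    rw [← ha, ← hb]
    exact a.equiv_apply l b (Equiv.refl _)
  set φ := (a.equiv b (Equiv.refl _)).toAddEquiv
  refine ⟨hφ, fun x y => ?_, fun ψ hψ =>
    repGroup_perm_hom_ext (g := φ.toAddMonoidHom) fun l => (hψ l).trans (hφ l).symm⟩
  -- The isometry is checked on generators one variable at a time, using additivity and then
  -- symmetry of both pairings.
  have h1 : ∀ (m : n.Partition) (x : RepGroup (Equiv.Perm (Fin n))),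
      ellipticPairingBar (WeylB.reflectionRep n) (φ x) (φ (repClass (sigmaRep m))) =
        characterPairing x (repClass (sigmaRep m)) := fun m => DFunLike.congr_fun
    (repGroup_perm_hom_ext
      (f := (ellipticPairingBarHom _ (φ (repClass (sigmaRep m)))).comp φ.toAddMonoidHom)
      (g := characterPairingHom (repClass (sigmaRep m))) fun l => by
        change ellipticPairingBar _ (φ _) (φ _) = characterPairing _ _
        rw [hφ, hφ, hbar, characterPairing_sigmaRep])
  rw [ellipticPairingBar_comm, characterPairing_comm_perm]
  exact DFunLike.congr_fun
    (repGroup_perm_hom_ext (f := (ellipticPairingBarHom _ (φ x)).comp φ.toAddMonoidHom)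
      (g := characterPairingHom x) fun l => by
        change ellipticPairingBar _ (φ _) (φ _) = characterPairing _ _
        rw [ellipticPairingBar_comm, h1, characterPairing_comm_perm]) y
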